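/- Let $1<\beta<2$. For $x\in[0,(\beta-1)^{-1}]$ a $\beta$-expansion of $x$ is a sequence $(a_n)_{n\ge1}\in\{0,1\}^{\mathbb N}$ with $x=\sum_{n\ge1}a_n\beta^{-n}$, and $U_\beta$ is the set of all $x$ having exactly one $\beta$-expansion. Put $T_0(x)=\beta x$, $T_1(x)=\beta x-1$. The greedy map $G$ is $T_0$ on $[0,\beta^{-1})$ and $T_1$ on $[\beta^{-1},(\beta-1)^{-1}]$; the greedy expansion of $1$ is the sequence $(a_n)_{n\ge1}$ with $a_n=1$ if $G^{n-1}(1)\ge\beta^{-1}$ and $a_n=0$ otherwise. The quasi-greedy orbit $(Q^n(1))_{n\ge1}$ of $1$ is $(G^n(1))_{n\ge1}$ if $a_n=1$ for infinitely many $n$; otherwise, if $a_1\cdots a_m0^\infty$ with $a_m=1$ is the greedy expansion of $1$ and $(\eta_i)_{i\ge1}=(a_1\cdots a_{m-1}0)^\infty$, it is given by $Q^n(1)=\sum_{i\ge1}\eta_{n+i}\beta^{-i}$. Assume that $Q^n(1)\notin(\beta^{-1},\beta^{-1}(\beta-1)^{-1}]$ for all $n\ge1$, and that the greedy expansion of $1$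 is eventually periodic (possibly ending in $0^\infty$). Let $\bar1=(2-\beta)(\beta-1)^{-1}$ be the reflection of $1$. Then the set $$\{G^n(1):n\ge0\}\cup\{G^n(\bar1):n\ge0\}\cup\{0,\,1,\,\beta^{-1},\,\beta^{-1}(\beta-1)^{-1},\,(\beta-1)^{-1}\}$$ is finite; write it as $\{c_1<\dots<c_p\}$ and put $A_i=[c_i,c_{i+1}]$ for $1\le i\le p-1$. Let $S$ be the $(p-1)\times(p-1)$ matrix with $S_{ij}=1$ if $A_j\subseteq T_{k(i)}(A_i)$ and $S_{ij}=0$ otherwise, where $k(i)=1$ if $c_i\ge\beta^{-1}$ and $k(i)=0$ otherwise. The switch region $[\beta^{-1},\beta^{-1}(\beta-1)^{-1}]$ is one of the blocks $A_i$; let $S'$ be obtained from $S$ by deleting the row and the column of this block, and let $r$ be the spectral radius of $S'$. Then $r\ge1$ and $$\dim_H U_\beta=\frac{\log r}{\log\beta}.$$ -/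

import Mathlib

open Set

namespace BetaExpansion

noncomputable section

/-- The value `∑_{n ≥ 1} aₙ β⁻ⁿ` of a 0-1 sequence in base `β`
(the sequence is indexed from `0` here, so `a n` is the digit at `β⁻⁽ⁿ⁺¹⁾`). -/
def value (β : ℝ) (a : ℕ → Fin 2) : ℝ := ∑' n, ((a n : ℕ) : ℝ) / β ^ (n + 1)

/-- The univoque set `U_β`: the points with exactly one `β`-expansion. -/
def univoqueSet (β : ℝ) : Set ℝ := {x | ∃! a : ℕ → Fin 2, value β a = x}

/-- The two expanding maps `T₀ x = β x` and `T₁ x = β x - 1`. -/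
def T (β : ℝ) (k : Fin 2) (x : ℝ) : ℝ := β * x - ((k : ℕ) : ℝ)

/-- The greedy choice of a digit: `1` as soon as `x ≥ β⁻¹`, and `0` otherwise.
It is `⌊β x⌋` for `x ∈ [0, 1]`, `1 < β < 2`. -/
def firstDigit (β x : ℝ) : Fin 2 := if x < 1 / β then 0 else 1

/-- The greedy map: `β x mod 1` on `[0, 1)` and `β x - 1` on `[1, (β - 1)⁻¹]`. -/
def greedyMap (β x : ℝ) : ℝ := T β (firstDigit β x) x

/-- The greedy expansion of `x` (indexed from `0`). -/
def greedyExpansion (β x : ℝ) (n : ℕ) : Fin 2 := firstDigit β ((greedyMap β)^[n] x)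

/-- A sequence is eventually periodic; sequences ending in `0^∞` are included. -/
def EventuallyPeriodic (a : ℕ → Fin 2) : Prop :=
  ∃ N p : ℕ, 0 < p ∧ ∀ n, N ≤ n → a (n + p) = a n

/-- `m` is the position of the last nonzero digit of `a` (so `a` is a finite expansion). -/
def IsLastNonzero (a : ℕ → Fin 2) (m : ℕ) : Prop := a m ≠ 0 ∧ ∀ k, m < k → a k = 0

/-- The periodic sequence `(a₁ ⋯ aₙ₋₁ aₙ⁻)^∞` with `aₙ⁻ = aₙ - 1`;
with indices from `0`, the block is `a 0, …, a m` and `n = m + 1`. -/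
def lowerPeriodic (a : ℕ → Fin 2) (m k : ℕ) : Fin 2 :=
  if k % (m + 1) = m then a m - 1 else a (k % (m + 1))

open Classical in
/-- The quasi-greedy orbit `Qⁿ(1)` of `1`: the greedy orbit if the greedy expansion of `1` is
infinite, and otherwise the values of the shifts of `(a₁ ⋯ aₙ⁻)^∞`, where `a₁ ⋯ aₙ 0^∞`, `aₙ ≠ 0`,
is the greedy expansion of `1`. -/
def quasiGreedyOrbit (β : ℝ) (n : ℕ) : ℝ :=
  if h : ∃ m, IsLastNonzero (greedyExpansion β 1) m then
    value β (fun k => lowerPeriodic (greedyExpansion β 1) h.choose (n + k))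
  else (greedyMap β)^[n] 1

/-- The reflection `(β - 1)⁻¹ - 1` of `1`. -/
def reflOne (β : ℝ) : ℝ := (2 - β) / (β - 1)

/-- The partition points: the greedy orbits of `1` and of its reflection (each with its starting
point), together with `0`, `1`, `(β - 1)⁻¹` and the endpoints of the switch region. -/
def partitionPoints (β : ℝ) : Set ℝ :=
  range (fun n : ℕ => (greedyMap β)^[n] 1) ∪ range (fun n : ℕ => (greedyMap β)^[n] (reflOne β)) ∪
    {1 / β, 1 / (β * (β - 1)), 0, 1, 1 / (β - 1)}

/-- The left endpoint of the `i`-th of the intervals into which the points of `P` cut the line. -/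
def left (P : Finset ℝ) (i : Fin (P.card - 1)) : ℝ := P.orderEmbOfFin rfl ⟨i, by omega⟩

/-- The right endpoint of the `i`-th interval. -/
def right (P : Finset ℝ) (i : Fin (P.card - 1)) : ℝ := P.orderEmbOfFin rfl ⟨i + 1, by omega⟩

/-- The block `A_i = [c_i, c_{i+1}]`, where `c_1 < c_2 < ⋯` are the points of `P`. -/
def block (P : Finset ℝ) (i : Fin (P.card - 1)) : Set ℝ := Icc (left P i) (right P i)

open Classical in
/-- The adjacency matrix `S`. The greedy choice `T_k` is applied to a whole block, i.e. `T₁` if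
the block lies in `[β⁻¹, ∞)` and `T₀` otherwise, and `S_{ij} = 1` iff `A_j ⊆ T_k(A_i)`. -/
def adjacency (β : ℝ) (P : Finset ℝ) : Matrix (Fin (P.card - 1)) (Fin (P.card - 1)) ℂ :=
  fun i j => if block P j ⊆ T β (firstDigit β (left P i)) '' block P i then 1 else 0

/-- The matrix `S'`: the row and the column of the block `s` are removed. -/
def reducedAdjacency (β : ℝ) (P : Finset ℝ) (s : Fin (P.card - 1)) :
    Matrix {i // i ≠ s} {i // i ≠ s} ℂ :=
  (adjacency β P).submatrix Subtype.val Subtype.val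

end

end BetaExpansion

/-!
The Hausdorff dimension of the univoque set `U_β` is read off from a Markov partition.

A point `x` of `[0, (β - 1)⁻¹]` lies in `U_β` exactly when its greedy orbit avoids the closed switch
region, since that is where both digits are possible
(`mem_univoqueSet_of_forall_notMem_switch`, `notMem_switch_of_mem_univoqueSet`). The hypothesis on
the quasi-greedy orbit keeps the greedy orbit of `1` out of the switch region, except for a possible
hit of its left endpoint `β⁻¹`; by reflection, the greedy orbit of the reflection of `1` meets the
switch region at most in its right endpoint. Hence the partition points are mapped to partition points, by `T₀` left of the switch region
and by `T₁` right of it, and the switch region is not subdivided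
(`isMarkovPartition_partitionPoints`).

*Upper bound.* A point of `U_β` follows a path of blocks that avoids the switch region. There are
`O(ρⁿ)` such paths of length `n` for each `ρ > r`, by Gelfand's formula, and each determines the
point up to `O(β⁻ⁿ)`; so these covers give `dim U_β ≤ log r / log β`
(`exists_cover_univoqueSet_inter_block`, `dimH_univoqueSet_le`). The block at the fixed point `0`
gives `r ≥ 1`.

*Lower bound.* For `r = 1` there is nothing to prove. For `r > 1` no mass distribution and no
Perron-Frobenius theory is needed: take any complex eigenvalue `μ` with `|μ| = r` and an eigenvector
`v`. There is a bounded function `Φ` which increases by `v i` over the `i`-th block, is constant on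
the switch region, and satisfies `Φ (T x) - Φ (T y) = μ (Φ x - Φ y)` on every other block
(`exists_isEigenprofile`); the eigenvector equation is what makes these requirements consistent.
Expanding distances by `β` multiplies increments by `μ`, so `Φ` is Hölder with exponent
`log r / log β`. Off `U_β` it takes only countably many values. As `Re Φ` is continuous and, for
normalised `v`, nonconstant, the image of `U_β` contains an interval up to a countable set and thus
has dimension `1`; the Hölder exponent then bounds `dim U_β` from below
(`IsEigenprofile.le_dimH_univoqueSet`).
-/

namespace BetaExpansion

/-! ### Expansions and the greedy map -/

lemma digit_cases (k : Fin 2) : k = 0 ∨ k = 1 := by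
  fin_cases k <;> simp

lemma digit_mem_Icc (k : Fin 2) : ((k : ℕ) : ℝ) ∈ Icc (0 : ℝ) 1 := by
  rcases digit_cases k with rfl | rfl <;> simp

lemma hasSum_inv_pow_succ {β : ℝ} (hβ : 1 < β) :
    HasSum (fun n : ℕ => 1 / β ^ (n + 1)) (1 / (β - 1)) := by
  have h0 : 0 < β := by linarith
  have h := (hasSum_geometric_of_lt_one (inv_nonneg.2 h0.le) (inv_lt_one_of_one_lt₀ hβ)).mul_left β⁻¹
  have e : β⁻¹ * (1 - β⁻¹)⁻¹ = 1 / (β - 1) := by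
    have : β - 1 ≠ 0 := by linarith
    field_simp
  rw [e] at h
  refine h.congr_fun fun n => ?_
  simp only [one_div, inv_pow, pow_succ, mul_inv]
  ring

lemma summable_value {β : ℝ} (hβ : 1 < β) (a : ℕ → Fin 2) :
    Summable fun n => ((a n : ℕ) : ℝ) / β ^ (n + 1) := by
  have h0 : 0 < β := by linarith
  refine (hasSum_inv_pow_succ hβ).summable.of_nonneg_of_le (fun n => ?_) (fun n => ?_)
  · have := (digit_mem_Icc (a n)).1
    positivity
  · have := (digit_mem_Icc (a n)).2
    gcongr

lemma value_mem_Icc {β : ℝ} (hβ : 1 < β) (a : ℕ → Fin 2) :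
    value β a ∈ Icc 0 (1 / (β - 1)) := by
  have h0 : 0 < β := by linarith
  refine ⟨tsum_nonneg fun n => ?_, ?_⟩
  · have := (digit_mem_Icc (a n)).1
    positivity
  · rw [← (hasSum_inv_pow_succ hβ).tsum_eq]
    refine (summable_value hβ a).tsum_le_tsum (fun n => ?_) (hasSum_inv_pow_succ hβ).summable
    have := (digit_mem_Icc (a n)).2
    gcongr

/-- Applying the map of the first digit shifts an expansion. -/
lemma T_value {β : ℝ} (hβ : 1 < β) (a : ℕ → Fin 2) :
    T β (a 0) (value β a) = value β fun n => a (n + 1) := by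
  have h0 : 0 < β := by linarith
  unfold T value
  rw [(summable_value hβ a).tsum_eq_zero_add, mul_add, ← tsum_mul_left]
  have : ∀ n : ℕ, β * (((a (n + 1) : ℕ) : ℝ) / β ^ (n + 1 + 1)) =
      ((a (n + 1) : ℕ) : ℝ) / β ^ (n + 1) := by
    intro n
    rw [pow_succ β (n + 1)]
    field_simp
  simp only [this]
  field_simp
  ring

lemma value_zero (β : ℝ) : value β (fun _ => 0) = 0 := by
  simp [value]

lemma one_le_inv_sub_one {β : ℝ} (hβ1 : 1 < β) (hβ2 : β < 2) : 1 ≤ 1 / (β - 1) := by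
  rw [le_div_iff₀ (by linarith)]
  linarith

lemma mul_fixed {β : ℝ} (hβ1 : 1 < β) : β * (1 / (β - 1)) = 1 / (β - 1) + 1 := by
  have : β - 1 ≠ 0 := by linarith
  field_simp
  ring

lemma mul_switchRight {β : ℝ} (hβ1 : 1 < β) : β * (1 / (β * (β - 1))) = 1 / (β - 1) := by
  have : β - 1 ≠ 0 := by linarith
  have : β ≠ 0 := by linarith
  field_simp

lemma inv_lt_switchRight {β : ℝ} (hβ1 : 1 < β) (hβ2 : β < 2) : 1 / β < 1 / (β * (β - 1)) := by
  apply one_div_lt_one_div_of_lt <;> nlinarith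

lemma T_zero_mem_iff {β x : ℝ} (hβ1 : 1 < β) :
    T β 0 x ∈ Icc 0 (1 / (β - 1)) ↔ x ∈ Icc 0 (1 / (β * (β - 1))) := by
  have h0 : 0 < β := by linarith
  have e := mul_switchRight hβ1
  simp only [T, Fin.val_zero, Nat.cast_zero, sub_zero, mem_Icc, ← e]
  rw [mul_le_mul_iff_right₀ h0, mul_nonneg_iff_of_pos_left h0]

lemma T_one_mem_iff {β x : ℝ} (hβ1 : 1 < β) :
    T β 1 x ∈ Icc 0 (1 / (β - 1)) ↔ x ∈ Icc (1 / β) (1 / (β - 1)) := by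
  have h0 : 0 < β := by linarith
  have e := mul_fixed hβ1
  have e' : β * (1 / β) = 1 := by field_simp
  simp only [T, Fin.val_one, Nat.cast_one, mem_Icc, sub_nonneg, sub_le_iff_le_add]
  nth_rw 1 [← e']
  rw [← e, mul_le_mul_iff_right₀ h0, mul_le_mul_iff_right₀ h0]

lemma firstDigit_of_lt {β x : ℝ} (h : x < 1 / β) : firstDigit β x = 0 := if_pos h

lemma firstDigit_of_le {β x : ℝ} (h : 1 / β ≤ x) : firstDigit β x = 1 := if_neg h.not_gt

lemma greedyMap_of_lt {β x : ℝ} (h : x < 1 / β) : greedyMap β x = β * x := by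
  simp [greedyMap, firstDigit_of_lt h, T]

lemma greedyMap_of_le {β x : ℝ} (h : 1 / β ≤ x) : greedyMap β x = β * x - 1 := by
  simp [greedyMap, firstDigit_of_le h, T]

lemma greedyMap_mem_Icc {β x : ℝ} (hβ1 : 1 < β) (hβ2 : β < 2) (hx : x ∈ Icc 0 (1 / (β - 1))) :
    greedyMap β x ∈ Icc 0 (1 / (β - 1)) := by
  unfold greedyMap
  rcases lt_or_ge x (1 / β) with h | h
  · rw [firstDigit_of_lt h, T_zero_mem_iff hβ1]
    exact ⟨hx.1, (h.trans (inv_lt_switchRight hβ1 hβ2)).le⟩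
  · rw [firstDigit_of_le h, T_one_mem_iff hβ1]
    exact ⟨h, hx.2⟩

lemma iterate_greedyMap_mem_Icc {β x : ℝ} (hβ1 : 1 < β) (hβ2 : β < 2)
    (hx : x ∈ Icc 0 (1 / (β - 1))) (n : ℕ) : (greedyMap β)^[n] x ∈ Icc 0 (1 / (β - 1)) := by
  induction n with
  | zero => exact hx
  | succ n ih =>
    rw [Function.iterate_succ_apply']
    exact greedyMap_mem_Icc hβ1 hβ2 ih

lemma value_greedyExpansion {β x : ℝ} (hβ1 : 1 < β) (hβ2 : β < 2)
    (hx : x ∈ Icc 0 (1 / (β - 1))) : value β (greedyExpansion β x) = x := by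
  have h0 : 0 < β := by linarith
  have hsum : ∀ n, ∑ k ∈ Finset.range n, ((greedyExpansion β x k : ℕ) : ℝ) / β ^ (k + 1) =
      x - (greedyMap β)^[n] x * β⁻¹ ^ n := by
    intro n
    induction n with
    | zero => simp
    | succ n ih =>
      rw [Finset.sum_range_succ, ih, Function.iterate_succ_apply', greedyMap, T, greedyExpansion, inv_pow,
        inv_pow, pow_succ]
      field_simp
      ring
  refine HasSum.tsum_eq ((summable_value hβ1 _).hasSum_iff_tendsto_nat.2 ?_)
  simp only [hsum]
  have ht : Filter.Tendsto (fun n : ℕ => (1 / (β - 1)) * β⁻¹ ^ n) Filter.atTop (nhds 0) := by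
    simpa using (tendsto_pow_atTop_nhds_zero_of_lt_one (inv_nonneg.2 h0.le)
      (inv_lt_one_of_one_lt₀ hβ1)).const_mul (1 / (β - 1))
  have := squeeze_zero (fun n => mul_nonneg (iterate_greedyMap_mem_Icc hβ1 hβ2 hx n).1
    (pow_nonneg (inv_nonneg.2 h0.le) n)) (fun n => mul_le_mul_of_nonneg_right
      (iterate_greedyMap_mem_Icc hβ1 hβ2 hx n).2 (pow_nonneg (inv_nonneg.2 h0.le) n)) ht
  simpa using this.const_sub x

lemma greedyExpansion_add (β x : ℝ) (n k : ℕ) :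
    greedyExpansion β x (k + n) = greedyExpansion β ((greedyMap β)^[n] x) k := by
  rw [greedyExpansion, greedyExpansion, Function.iterate_add_apply]

lemma iterate_greedyMap_eq_value {β x : ℝ} (hβ1 : 1 < β) (hβ2 : β < 2)
    (hx : x ∈ Icc 0 (1 / (β - 1))) (n : ℕ) :
    (greedyMap β)^[n] x = value β fun k => greedyExpansion β x (k + n) := by
  simp only [greedyExpansion_add]
  exact (value_greedyExpansion hβ1 hβ2 (iterate_greedyMap_mem_Icc hβ1 hβ2 hx n)).symm

/-! ### The univoque set -/

/-- Prepending a digit to an expansion of `T β k x` gives an expansion of `x`. -/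
lemma value_cons {β x : ℝ} (hβ : 1 < β) {k : Fin 2} {b : ℕ → Fin 2}
    (hb : value β b = T β k x) : value β (fun n => Nat.casesOn n k b) = x := by
  have h0 : 0 < β := by linarith
  have h := T_value hβ (fun n => Nat.casesOn n k b : ℕ → Fin 2)
  simp only [T] at h hb
  rw [hb] at h
  have := mul_left_cancel₀ h0.ne' (sub_left_injective h)
  exact this

lemma univoqueSet_subset {β : ℝ} (hβ1 : 1 < β) : univoqueSet β ⊆ Icc 0 (1 / (β - 1)) := by
  rintro x ⟨a, rfl, -⟩
  exact value_mem_Icc hβ1 a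

lemma notMem_switch_of_mem_univoqueSet {β x : ℝ} (hβ1 : 1 < β) (hβ2 : β < 2)
    (hx : x ∈ univoqueSet β) : x ∉ Icc (1 / β) (1 / (β * (β - 1))) := by
  intro hs
  have hL := univoqueSet_subset hβ1 hx
  -- both maps keep a point of the switch region in the domain, so either digit can come first
  have h0 := value_greedyExpansion hβ1 hβ2 ((T_zero_mem_iff hβ1).2 ⟨hL.1, hs.2⟩)
  have h1 := value_greedyExpansion hβ1 hβ2 ((T_one_mem_iff hβ1).2 ⟨hs.1, hL.2⟩)
  have := congrFun (hx.unique (value_cons hβ1 h0) (value_cons hβ1 h1)) 0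
  simp at this

lemma greedyMap_mem_univoqueSet {β x : ℝ} (hβ1 : 1 < β) (hβ2 : β < 2)
    (hx : x ∈ univoqueSet β) : greedyMap β x ∈ univoqueSet β := by
  have hL := univoqueSet_subset hβ1 hx
  have hg := value_greedyExpansion hβ1 hβ2 (greedyMap_mem_Icc hβ1 hβ2 hL)
  refine ⟨_, hg, fun b hb => ?_⟩
  have := hx.unique (value_cons hβ1 hb) (value_cons hβ1 hg)
  funext n
  exact congrFun this (n + 1)

lemma mem_univoqueSet_of_forall_notMem_switch {β x : ℝ} (hβ1 : 1 < β) (hβ2 : β < 2)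
    (hx : x ∈ Icc 0 (1 / (β - 1)))
    (h : ∀ n, (greedyMap β)^[n] x ∉ Icc (1 / β) (1 / (β * (β - 1)))) : x ∈ univoqueSet β := by
  refine ⟨_, value_greedyExpansion hβ1 hβ2 hx, fun b hb => ?_⟩
  have first : ∀ (c : ℕ → Fin 2), value β c ∉ Icc (1 / β) (1 / (β * (β - 1))) →
      c 0 = firstDigit β (value β c) := by
    intro c hc
    have hm := value_mem_Icc hβ1 fun n => c (n + 1)
    rw [← T_value hβ1] at hm
    rcases digit_cases (c 0) with h0 | h0
    · rw [h0, T_zero_mem_iff hβ1] at hm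
      rw [h0, firstDigit_of_lt]
      by_contra hlt
      exact hc ⟨not_lt.1 hlt, hm.2⟩
    · rw [h0, T_one_mem_iff hβ1] at hm
      rw [h0, firstDigit_of_le hm.1]
  have key : ∀ n, value β (fun k => b (k + n)) = (greedyMap β)^[n] x := by
    intro n
    induction n with
    | zero => exact hb
    | succ n ih =>
      have hf := first (fun k => b (k + n)) (by rw [ih]; exact h n)
      have ht := T_value hβ1 (fun k => b (k + n))
      rw [hf, ih] at ht
      rw [Function.iterate_succ_apply', greedyMap, ht]
      congr 1
      funext k
      congr 1
      ring
  funext n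
  have hf := first (fun k => b (k + n)) (by rw [key n]; exact h n)
  rw [key n] at hf
  simpa [greedyExpansion] using hf

/-! ### The orbits of `1` and of its reflection -/

lemma one_mem_Icc {β : ℝ} (hβ1 : 1 < β) (hβ2 : β < 2) : (1 : ℝ) ∈ Icc 0 (1 / (β - 1)) :=
  ⟨zero_le_one, one_le_inv_sub_one hβ1 hβ2⟩

lemma inv_lt_one_of_base {β : ℝ} (hβ1 : 1 < β) : 1 / β < 1 := by
  rw [div_lt_one (by linarith)]
  exact hβ1

lemma iterate_greedyMap_one_le {β : ℝ} (hβ1 : 1 < β) (hβ2 : β < 2) (n : ℕ) :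
    (greedyMap β)^[n] 1 ≤ 1 := by
  induction n with
  | zero => exact le_rfl
  | succ n ih =>
    rw [Function.iterate_succ_apply']
    rcases lt_or_ge ((greedyMap β)^[n] 1) (1 / β) with h | h
    · rw [greedyMap_of_lt h]
      rw [lt_div_iff₀ (by linarith)] at h
      linarith
    · rw [greedyMap_of_le h]
      nlinarith

lemma iterate_greedyMap_zero {β : ℝ} (hβ1 : 1 < β) (n : ℕ) : (greedyMap β)^[n] 0 = 0 := by
  have h : greedyMap β 0 = 0 := by
    rw [greedyMap_of_lt (by have : 0 < β := by linarith
                            positivity), mul_zero]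
  exact Function.iterate_fixed h n

lemma greedyExpansion_one_zero {β : ℝ} (hβ1 : 1 < β) : greedyExpansion β 1 0 = 1 :=
  firstDigit_of_le (inv_lt_one_of_base hβ1).le

/-- The greedy orbit of `1` hits `β⁻¹` exactly at the last nonzero digit of a finite expansion. -/
lemma isLastNonzero_iff {β : ℝ} (hβ1 : 1 < β) (hβ2 : β < 2) (n : ℕ) :
    IsLastNonzero (greedyExpansion β 1) n ↔ (greedyMap β)^[n] 1 = 1 / β := by
  have h0 : 0 < β := by linarith
  have e : β * (1 / β) = 1 := by field_simp
  constructor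
  · rintro ⟨hn, hz⟩
    have h1 : 1 / β ≤ (greedyMap β)^[n] 1 := by
      by_contra h
      exact hn (firstDigit_of_lt (not_le.1 h))
    have h2 : (greedyMap β)^[n + 1] 1 = 0 := by
      rw [iterate_greedyMap_eq_value hβ1 hβ2 (one_mem_Icc hβ1 hβ2), ← value_zero β]
      congr 1
      funext k
      exact hz _ (by omega)
    rw [Function.iterate_succ_apply', greedyMap_of_le h1] at h2
    rw [eq_div_iff h0.ne']
    linarith
  · intro h
    have h2 : (greedyMap β)^[n + 1] 1 = 0 := by
      rw [Function.iterate_succ_apply', greedyMap_of_le h.ge, h, e, sub_self]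
    refine ⟨?_, fun k hk => ?_⟩
    · rw [greedyExpansion, firstDigit_of_le h.ge]
      decide
    · obtain ⟨j, rfl⟩ := Nat.exists_eq_add_of_le' (Nat.succ_le_of_lt hk)
      rw [greedyExpansion, Function.iterate_add_apply, h2, iterate_greedyMap_zero hβ1,
        firstDigit_of_lt (by positivity)]

/-- If the greedy expansion of `1` is finite with last nonzero digit at `m`, then the
quasi-greedy expansion is again an expansion of `1`, and its orbit agrees with the greedy one
up to time `m`. -/
lemma value_lowerPeriodic {β : ℝ} (hβ1 : 1 < β) (hβ2 : β < 2) {m : ℕ}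
    (hm : IsLastNonzero (greedyExpansion β 1) m) {n : ℕ} (hn : n ≤ m) :
    value β (fun k => lowerPeriodic (greedyExpansion β 1) m (n + k)) = (greedyMap β)^[n] 1 := by
  have h0 : 0 < β := by linarith
  set a := greedyExpansion β 1 with ha
  set V : ℕ → ℝ := fun n => value β (fun k => lowerPeriodic a m (n + k)) with hV
  have step : ∀ n, V (n + 1) = β * V n - ((lowerPeriodic a m n : ℕ) : ℝ) := by
    intro n
    have := T_value hβ1 (fun k => lowerPeriodic a m (n + k))
    simp only [T, add_zero] at this
    rw [hV]
    simp only
    rw [this]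
    congr 1
    funext k
    congr 1
    ring
  have per : V (m + 1) = V 0 := by
    simp only [hV]
    congr 1
    funext k
    simp [lowerPeriodic]
  have low : ∀ n < m, lowerPeriodic a m n = a n := by
    intro n hn
    have : n % (m + 1) = n := Nat.mod_eq_of_lt (by omega)
    simp [lowerPeriodic, this, hn.ne]
  have top : lowerPeriodic a m m = 0 := by
    have h1 : a m = 1 := (digit_cases (a m)).resolve_left hm.1
    have : m % (m + 1) = m := Nat.mod_eq_of_lt (by omega)
    simp [lowerPeriodic, this, h1]
  have diff : ∀ n ≤ m, V n - (greedyMap β)^[n] 1 = β ^ n * (V 0 - 1) := by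
    intro n
    induction n with
    | zero => simp
    | succ n ih =>
      intro hn
      have ih := ih (by omega)
      rw [step, low n (by omega), Function.iterate_succ_apply', greedyMap, T, pow_succ]
      simp only [ha, greedyExpansion]
      linear_combination β * ih
  -- one full period forces the deviation `V 0 - 1` to be expanded by `β ^ (m + 1)` and unchanged
  have hm' := diff m le_rfl
  rw [(isLastNonzero_iff hβ1 hβ2 m).1 hm] at hm'
  have e : β * (1 / β) = 1 := by field_simp
  have s := step m
  rw [top, per] at s
  simp only [Fin.val_zero, Nat.cast_zero, sub_zero] at s
  have hp : 1 < β ^ (m + 1) := one_lt_pow₀ hβ1 (by omega)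
  have z : (β ^ (m + 1) - 1) * (V 0 - 1) = 0 := by
    rw [pow_succ]
    linear_combination -s - β * hm' - e
  have z' : V 0 - 1 = 0 := by
    rcases mul_eq_zero.1 z with h | h
    · linarith
    · exact h
  have := diff n hn
  rw [z', mul_zero] at this
  linarith

/-- The orbit hypothesis in terms of the greedy map alone. It also covers `n = 0`, that is,
it forces `1` to lie to the right of the switch region. -/
lemma iterate_greedyMap_one_notMem {β : ℝ} (hβ1 : 1 < β) (hβ2 : β < 2)
    (horbit : ∀ n : ℕ, 1 ≤ n → quasiGreedyOrbit β n ∉ Ioc (1 / β) (1 / (β * (β - 1)))) (n : ℕ) :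
    (greedyMap β)^[n] 1 ∉ Ioc (1 / β) (1 / (β * (β - 1))) := by
  have h0 : 0 < β := by linarith
  have hlt := inv_lt_one_of_base hβ1
  by_cases hfin : ∃ m, IsLastNonzero (greedyExpansion β 1) m
  · have hm := hfin.choose_spec
    set m := hfin.choose with hmdef
    have hq : ∀ n, quasiGreedyOrbit β n =
        value β (fun k => lowerPeriodic (greedyExpansion β 1) m (n + k)) := by
      intro n
      rw [quasiGreedyOrbit, dif_pos hfin]
    have hone : (1 : ℝ) ∉ Ioc (1 / β) (1 / (β * (β - 1))) := by
      have h := horbit (m + 1) (by omega)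
      rw [hq] at h
      have hV := value_lowerPeriodic hβ1 hβ2 hm (Nat.zero_le m)
      have hk : ∀ k, lowerPeriodic (greedyExpansion β 1) m (m + 1 + k) =
          lowerPeriodic (greedyExpansion β 1) m (0 + k) := by
        intro k
        simp [lowerPeriodic]
      simp only [hk] at h
      rwa [hV] at h
    rcases Nat.eq_zero_or_pos n with rfl | hn
    · exact hone
    rcases le_or_gt n m with hnm | hnm
    · have h := horbit n hn
      rwa [hq, value_lowerPeriodic hβ1 hβ2 hm hnm] at h
    · obtain ⟨j, rfl⟩ := Nat.exists_eq_add_of_le' (Nat.succ_le_of_lt hnm)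
      have h1 := (isLastNonzero_iff hβ1 hβ2 m).1 hm
      have e : β * (1 / β) = 1 := by field_simp
      rw [Function.iterate_add_apply, Function.iterate_succ_apply', h1, greedyMap_of_le le_rfl, e,
        sub_self, iterate_greedyMap_zero hβ1]
      intro h
      have := h.1
      have : 0 < 1 / β := by positivity
      linarith
  · have hq : ∀ n, 1 ≤ n → (greedyMap β)^[n] 1 ∉ Ioc (1 / β) (1 / (β * (β - 1))) := by
      intro n hn
      have h := horbit n hn
      rwa [quasiGreedyOrbit, dif_neg hfin] at h
    rcases Nat.eq_zero_or_pos n with rfl | hn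
    · -- otherwise `(β⁻¹, 1]` lies in the switch region, so every digit after the first is `0`
      intro h
      refine hfin ⟨0, by rw [greedyExpansion_one_zero hβ1]; decide, fun k hk => ?_⟩
      refine firstDigit_of_lt ?_
      by_contra hge
      rcases (not_lt.1 hge).eq_or_lt with heq | hgt
      · exact hfin ⟨k, (isLastNonzero_iff hβ1 hβ2 k).2 heq.symm⟩
      · exact hq k hk ⟨hgt, (iterate_greedyMap_one_le hβ1 hβ2 k).trans h.2⟩
    · exact hq n hn

lemma reflOne_eq {β : ℝ} (hβ1 : 1 < β) : reflOne β = 1 / (β - 1) - 1 := by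
  have : β - 1 ≠ 0 := by linarith
  rw [reflOne]
  field_simp
  ring

/-- The greedy orbit of the reflection of `1` consists of reflections of points of the greedy
orbit of `1` (at a hit of the switch region it restarts). -/
lemma exists_iterate_greedyMap_reflOne {β : ℝ} (hβ1 : 1 < β) (hβ2 : β < 2)
    (hG : ∀ n, (greedyMap β)^[n] 1 ∉ Ioc (1 / β) (1 / (β * (β - 1)))) (n : ℕ) :
    ∃ k, (greedyMap β)^[n] (reflOne β) = 1 / (β - 1) - (greedyMap β)^[k] 1 := by
  have h0 : 0 < β := by linarith
  have e := mul_fixed hβ1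
  have hlt := inv_lt_switchRight hβ1 hβ2
  have e' : 1 / β + 1 / (β * (β - 1)) = 1 / (β - 1) := by
    have : β - 1 ≠ 0 := by linarith
    field_simp
    ring
  have e1 : β * (1 / β) = 1 := by field_simp
  induction n with
  | zero => exact ⟨0, by simpa using reflOne_eq hβ1⟩
  | succ n ih =>
    obtain ⟨k, hk⟩ := ih
    rw [Function.iterate_succ_apply', hk]
    set y := (greedyMap β)^[k] 1 with hy
    rcases lt_trichotomy y (1 / β) with h | h | h
    · refine ⟨k + 1, ?_⟩
      rw [Function.iterate_succ_apply', ← hy, greedyMap_of_lt h, greedyMap_of_le]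
      · linear_combination e
      · linarith
    · refine ⟨0, ?_⟩
      rw [Function.iterate_zero_apply, greedyMap_of_le, h]
      · linear_combination e - e1
      · linarith
    · have hsw : 1 / (β * (β - 1)) < y := by
        by_contra hle
        exact hG k ⟨h, not_lt.1 hle⟩
      refine ⟨k + 1, ?_⟩
      rw [Function.iterate_succ_apply', ← hy, greedyMap_of_le h.le, greedyMap_of_lt (by linarith)]
      linear_combination e

lemma finite_range_iterate_greedyMap_one {β : ℝ} (hβ1 : 1 < β) (hβ2 : β < 2)
    (hper : EventuallyPeriodic (greedyExpansion β 1)) :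
    (range fun n : ℕ => (greedyMap β)^[n] 1).Finite := by
  obtain ⟨N, p, hp, h⟩ := hper
  have hstep : ∀ n, N ≤ n → (greedyMap β)^[n + p] 1 = (greedyMap β)^[n] 1 := by
    intro n hn
    rw [iterate_greedyMap_eq_value hβ1 hβ2 (one_mem_Icc hβ1 hβ2),
      iterate_greedyMap_eq_value hβ1 hβ2 (one_mem_Icc hβ1 hβ2)]
    congr 1
    funext k
    rw [← add_assoc, h _ (by omega)]
  refine ((Finset.range (N + p)).finite_toSet.image fun n => (greedyMap β)^[n] 1).subset ?_
  rintro _ ⟨n, rfl⟩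
  induction n using Nat.strong_induction_on with
  | _ n ih =>
    rcases lt_or_ge n (N + p) with hn | hn
    · exact ⟨n, by simpa using hn, rfl⟩
    · have := hstep (n - p) (by omega)
      rw [Nat.sub_add_cancel (by omega)] at this
      simp only [this]
      exact ih _ (by omega)

lemma finite_partitionPoints {β : ℝ} (hβ1 : 1 < β) (hβ2 : β < 2)
    (hG : ∀ n, (greedyMap β)^[n] 1 ∉ Ioc (1 / β) (1 / (β * (β - 1))))
    (hper : EventuallyPeriodic (greedyExpansion β 1)) : (partitionPoints β).Finite := by
  have h1 := finite_range_iterate_greedyMap_one hβ1 hβ2 hper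
  refine (h1.union ((h1.image fun y => 1 / (β - 1) - y).subset ?_)).union (toFinite _)
  rintro _ ⟨n, rfl⟩
  obtain ⟨k, hk⟩ := exists_iterate_greedyMap_reflOne hβ1 hβ2 hG n
  exact ⟨_, ⟨k, rfl⟩, hk.symm⟩

/-- A finite set of points of `[0, (β - 1)⁻¹]`, containing the endpoints of this interval and of
the switch region, that cuts it into a Markov partition: the switch region is not subdivided,
and `T₀` to the left of it, `T₁` to the right of it, map division points to division points. -/
structure IsMarkovPartition (β : ℝ) (P : Finset ℝ) : Prop where
  mem_Icc : ∀ c ∈ P, c ∈ Icc 0 (1 / (β - 1))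
  zero_mem : 0 ∈ P
  fixed_mem : 1 / (β - 1) ∈ P
  inv_mem : 1 / β ∈ P
  switchRight_mem : 1 / (β * (β - 1)) ∈ P
  notMem_Ioo : ∀ c ∈ P, c ∉ Ioo (1 / β) (1 / (β * (β - 1)))
  mul_mem : ∀ c ∈ P, c ≤ 1 / β → β * c ∈ P
  mul_sub_one_mem : ∀ c ∈ P, 1 / (β * (β - 1)) ≤ c → β * c - 1 ∈ P

lemma isMarkovPartition_partitionPoints {β : ℝ} (hβ1 : 1 < β) (hβ2 : β < 2)
    (hG : ∀ n, (greedyMap β)^[n] 1 ∉ Ioc (1 / β) (1 / (β * (β - 1))))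
    (hfin : (partitionPoints β).Finite) : IsMarkovPartition β hfin.toFinset := by
  have h0 : 0 < β := by linarith
  have hL := one_le_inv_sub_one hβ1 hβ2
  have hlt := inv_lt_switchRight hβ1 hβ2
  have hinv : 0 < 1 / β := by positivity
  have e1 : β * (1 / β) = 1 := by field_simp
  have e' : 1 / β + 1 / (β * (β - 1)) = 1 / (β - 1) := by
    have : β - 1 ≠ 0 := by linarith
    field_simp
    ring
  have hG1 : ∀ n, (greedyMap β)^[n] 1 ∈ partitionPoints β := fun n =>
    Or.inl (Or.inl ⟨n, rfl⟩)
  have hG2 : ∀ n, (greedyMap β)^[n] (reflOne β) ∈ partitionPoints β := fun n =>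
    Or.inl (Or.inr ⟨n, rfl⟩)
  have hsw := hG 0
  rw [Function.iterate_zero_apply] at hsw
  have hsw1 : 1 / (β * (β - 1)) < 1 := by
    by_contra h
    exact hsw ⟨inv_lt_one_of_base hβ1, not_lt.1 h⟩
  have refl_notMem : ∀ n, (greedyMap β)^[n] (reflOne β) ∉ Ico (1 / β) (1 / (β * (β - 1))) := by
    intro n hn
    obtain ⟨k, hk⟩ := exists_iterate_greedyMap_reflOne hβ1 hβ2 hG n
    rw [hk] at hn
    exact hG k ⟨by linarith [hn.2], by linarith [hn.1]⟩
  constructor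
  · intro c hc
    rw [Finite.mem_toFinset] at hc
    rcases hc with (⟨n, rfl⟩ | ⟨n, rfl⟩) | rfl | rfl | rfl | rfl | rfl
    · exact iterate_greedyMap_mem_Icc hβ1 hβ2 (one_mem_Icc hβ1 hβ2) n
    · refine iterate_greedyMap_mem_Icc hβ1 hβ2 ?_ n
      rw [reflOne_eq hβ1]
      constructor <;> linarith
    all_goals constructor <;> linarith
  · simp [partitionPoints]
  · simp [partitionPoints]
  · simp [partitionPoints]
  · simp [partitionPoints]
  · intro c hc h
    rw [Finite.mem_toFinset] at hc
    rcases hc with (⟨n, rfl⟩ | ⟨n, rfl⟩) | rfl | rfl | rfl | rfl | rfl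
    · exact hG n ⟨h.1, h.2.le⟩
    · exact refl_notMem n ⟨h.1.le, h.2⟩
    all_goals linarith [h.1, h.2]
  · intro c hc h
    rw [Finite.mem_toFinset] at hc ⊢
    rcases h.eq_or_lt with rfl | h'
    · rw [e1]
      exact hG1 0
    rw [← greedyMap_of_lt h']
    rcases hc with (⟨n, rfl⟩ | ⟨n, rfl⟩) | rfl | rfl | rfl | rfl | rfl
    · simpa only [Function.iterate_succ_apply'] using hG1 (n + 1)
    · simpa only [Function.iterate_succ_apply'] using hG2 (n + 1)
    · exact absurd h' (lt_irrefl _)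
    · exact absurd h' hlt.not_gt
    · rw [greedyMap_of_lt h', mul_zero]
      simp [partitionPoints]
    · linarith
    · linarith
  · intro c hc h
    rw [Finite.mem_toFinset] at hc ⊢
    rcases hc with (⟨n, rfl⟩ | ⟨n, rfl⟩) | rfl | rfl | rfl | rfl | rfl
    · rw [← greedyMap_of_le (hlt.le.trans h)]
      simpa only [Function.iterate_succ_apply'] using hG1 (n + 1)
    · rw [← greedyMap_of_le (hlt.le.trans h)]
      simpa only [Function.iterate_succ_apply'] using hG2 (n + 1)
    · exact absurd h hlt.not_ge
    · rw [mul_switchRight hβ1, ← reflOne_eq hβ1]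
      exact hG2 0
    · linarith
    · have := hG1 1
      rwa [Function.iterate_one, greedyMap_of_le (hlt.le.trans h)] at this
    · rw [mul_fixed hβ1, add_sub_cancel_right]
      simp [partitionPoints]

/-! ### Blocks of a finite set of division points -/

section Blocks

variable {P : Finset ℝ}

lemma left_mem (i : Fin (P.card - 1)) : left P i ∈ P := P.orderEmbOfFin_mem rfl _

lemma right_mem (i : Fin (P.card - 1)) : right P i ∈ P := P.orderEmbOfFin_mem rfl _

lemma left_lt_right (i : Fin (P.card - 1)) : left P i < right P i :=
  (P.orderEmbOfFin rfl).strictMono (Fin.mk_lt_mk.2 (Nat.lt_succ_self _))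

lemma exists_orderEmbOfFin_eq {c : ℝ} (hc : c ∈ P) : ∃ k, P.orderEmbOfFin rfl k = c := by
  have : c ∈ range (P.orderEmbOfFin rfl) := by rwa [P.range_orderEmbOfFin rfl]
  exact this

/-- No division point lies strictly inside a block. -/
lemma le_left_or_right_le {c : ℝ} (hc : c ∈ P) (i : Fin (P.card - 1)) :
    c ≤ left P i ∨ right P i ≤ c := by
  obtain ⟨k, rfl⟩ := exists_orderEmbOfFin_eq hc
  rw [left, right, (P.orderEmbOfFin rfl).le_iff_le, (P.orderEmbOfFin rfl).le_iff_le, Fin.le_def,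
    Fin.le_def]
  simp only
  omega

lemma exists_left_eq {c d : ℝ} (hc : c ∈ P) (hd : d ∈ P) (h : c < d) : ∃ i, left P i = c := by
  obtain ⟨k, rfl⟩ := exists_orderEmbOfFin_eq hc
  obtain ⟨l, rfl⟩ := exists_orderEmbOfFin_eq hd
  have hkl := (P.orderEmbOfFin rfl).lt_iff_lt.1 h
  exact ⟨⟨k, by omega⟩, rfl⟩

lemma exists_right_eq {c d : ℝ} (hc : c ∈ P) (hd : d ∈ P) (h : d < c) : ∃ i, right P i = c := by
  obtain ⟨k, rfl⟩ := exists_orderEmbOfFin_eq hc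
  obtain ⟨l, rfl⟩ := exists_orderEmbOfFin_eq hd
  have hkl := (P.orderEmbOfFin rfl).lt_iff_lt.1 h
  refine ⟨⟨k - 1, by omega⟩, ?_⟩
  have : (k : ℕ) - 1 + 1 = k := by omega
  simp only [right, this]

/-- The half-open blocks between two division points cover the half-open interval between them. -/
lemma exists_mem_Ico {a b y : ℝ} (ha : a ∈ P) (hb : b ∈ P) (hy : y ∈ Ico a b) :
    ∃ i, y ∈ Ico (left P i) (right P i) ∧ a ≤ left P i ∧ right P i ≤ b := by
  have hne : (P.filter (· ≤ y)).Nonempty := ⟨a, by simp [ha, hy.1]⟩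
  obtain ⟨hcP, hcy⟩ := Finset.mem_filter.1 ((P.filter (· ≤ y)).max'_mem hne)
  have hmax : ∀ d ∈ P, d ≤ y → d ≤ (P.filter (· ≤ y)).max' hne := fun d hd hdy =>
    Finset.le_max' _ _ (Finset.mem_filter.2 ⟨hd, hdy⟩)
  set c := (P.filter (· ≤ y)).max' hne
  obtain ⟨i, hi⟩ := exists_left_eq hcP hb (hcy.trans_lt hy.2)
  refine ⟨i, ⟨hi ▸ hcy, ?_⟩, hi ▸ hmax a ha hy.1, ?_⟩
  · by_contra h
    have := hmax _ (right_mem i) (not_lt.1 h)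
    linarith [left_lt_right i]
  · refine (le_left_or_right_le hb i).resolve_left fun h => ?_
    linarith [hy.2]

lemma exists_mem_block {a b y : ℝ} (ha : a ∈ P) (hb : b ∈ P) (hab : a < b) (hy : y ∈ Icc a b) :
    ∃ i, y ∈ block P i ∧ a ≤ left P i ∧ right P i ≤ b := by
  rcases hy.2.eq_or_lt with rfl | h
  · obtain ⟨i, hi⟩ := exists_right_eq hb ha hab
    refine ⟨i, ⟨hi ▸ (left_lt_right i).le, hi.ge⟩, ?_, hi.le⟩
    refine (le_left_or_right_le ha i).resolve_right fun h => ?_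
    linarith
  · obtain ⟨i, hi, h1, h2⟩ := exists_mem_Ico ha hb ⟨hy.1, h⟩
    exact ⟨i, Ico_subset_Icc_self hi, h1, h2⟩

lemma eq_of_left_eq {i j : Fin (P.card - 1)} (h : left P i = left P j) : i = j := by
  have := (P.orderEmbOfFin rfl).injective h
  simpa [Fin.ext_iff] using this

lemma eq_of_mem_Ico {x : ℝ} {i j : Fin (P.card - 1)} (hi : x ∈ Ico (left P i) (right P i))
    (hj : x ∈ Ico (left P j) (right P j)) : i = j := by
  refine eq_of_left_eq (le_antisymm ?_ ?_)
  · exact (le_left_or_right_le (left_mem i) j).resolve_right fun h => by linarith [hi.1, hj.2]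
  · exact (le_left_or_right_le (left_mem j) i).resolve_right fun h => by linarith [hj.1, hi.2]

/-- The sum of `v` over the blocks to the left of `c`. -/
noncomputable def blockSum (P : Finset ℝ) (v : Fin (P.card - 1) → ℂ) (c : ℝ) : ℂ :=
  ∑ j with right P j ≤ c, v j

lemma blockSum_sub (v : Fin (P.card - 1) → ℂ) {a b : ℝ} (ha : a ∈ P) (hab : a ≤ b) :
    blockSum P v b - blockSum P v a = ∑ j with a ≤ left P j ∧ right P j ≤ b, v j := by
  rw [sub_eq_iff_eq_add, blockSum, blockSum, ← Finset.sum_union]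
  · congr 1
    ext j
    simp only [Finset.mem_filter_univ, Finset.mem_union]
    constructor
    · intro h
      exact (le_left_or_right_le ha j).imp (fun h' => ⟨h', h⟩) id
    · rintro (h | h)
      · exact h.2
      · exact h.trans hab
  · refine Finset.disjoint_filter.2 fun j _ h h' => ?_
    linarith [left_lt_right j]

lemma blockSum_right_sub_left (v : Fin (P.card - 1) → ℂ) (i : Fin (P.card - 1)) :
    blockSum P v (right P i) - blockSum P v (left P i) = v i := by
  rw [blockSum_sub v (left_mem i) (left_lt_right i).le, Finset.sum_eq_single_of_mem i]
  · simp
  · intro j hj hji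
    refine absurd (eq_of_left_eq (le_antisymm ?_ (Finset.mem_filter.1 hj).2.1)) hji
    refine (le_left_or_right_le (left_mem j) i).resolve_right fun h => ?_
    linarith [left_lt_right j, (Finset.mem_filter.1 hj).2.2]

lemma norm_blockSum_le (v : Fin (P.card - 1) → ℂ) (c : ℝ) : ‖blockSum P v c‖ ≤ ∑ j, ‖v j‖ :=
  (norm_sum_le _ _).trans
    (Finset.sum_le_sum_of_subset_of_nonneg (Finset.filter_subset _ _) fun _ _ _ => norm_nonneg _)

end Blocks

/-! ### Images of blocks -/

lemma T_sub_T (β : ℝ) (k : Fin 2) (x y : ℝ) : T β k x - T β k y = β * (x - y) := by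
  unfold T
  ring

lemma T_image_Icc {β : ℝ} (hβ1 : 1 < β) (k : Fin 2) (a b : ℝ) :
    T β k '' Icc a b = Icc (T β k a) (T β k b) := by
  have h0 : 0 < β := by linarith
  have h : T β k = (fun x => x - ((k : ℕ) : ℝ)) ∘ fun x => β * x := rfl
  rw [h, image_comp, image_mul_left_Icc' h0, image_sub_const_Icc]
  rfl

open Classical in
lemma adjacency_apply {β : ℝ} (hβ1 : 1 < β) (P : Finset ℝ) (i j : Fin (P.card - 1)) :
    adjacency β P i j = if T β (firstDigit β (left P i)) (left P i) ≤ left P j ∧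
      right P j ≤ T β (firstDigit β (left P i)) (right P i) then 1 else 0 := by
  rw [adjacency, block, block, T_image_Icc hβ1]
  simp only [Icc_subset_Icc_iff (left_lt_right j).le]

section Markov

variable {β : ℝ} {P : Finset ℝ} {s : Fin (P.card - 1)}

lemma IsMarkovPartition.exists_switch (hβ1 : 1 < β) (hβ2 : β < 2) (hP : IsMarkovPartition β P) :
    ∃ s : Fin (P.card - 1), block P s = Icc (1 / β) (1 / (β * (β - 1))) := by
  have hlt := inv_lt_switchRight hβ1 hβ2
  obtain ⟨s, hs⟩ := exists_left_eq hP.inv_mem hP.switchRight_mem hlt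
  have h1 := (le_left_or_right_le hP.switchRight_mem s).resolve_left fun h => by linarith
  have h2 : right P s = 1 / (β * (β - 1)) := by
    refine h1.eq_or_lt.resolve_right fun h => hP.notMem_Ioo _ (right_mem s) ⟨?_, h⟩
    rw [← hs]
    exact left_lt_right s
  exact ⟨s, by rw [block, hs, h2]⟩

lemma switch_endpoints (hs : block P s = Icc (1 / β) (1 / (β * (β - 1)))) :
    left P s = 1 / β ∧ right P s = 1 / (β * (β - 1)) :=
  (Icc_eq_Icc_iff (left_lt_right s).le).1 hs

/-- Every block other than the switch region lies on one side of it. -/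
lemma block_cases (hP : IsMarkovPartition β P)
    (hs : block P s = Icc (1 / β) (1 / (β * (β - 1)))) {i : Fin (P.card - 1)} (hi : i ≠ s) :
    (right P i ≤ 1 / β ∧ firstDigit β (left P i) = 0) ∨
      (1 / (β * (β - 1)) ≤ left P i ∧ firstDigit β (left P i) = 1) := by
  obtain ⟨h1, h2⟩ := switch_endpoints hs
  rcases le_left_or_right_le hP.inv_mem i with h | h
  · right
    refine ⟨(le_left_or_right_le hP.switchRight_mem i).resolve_right fun h' => hi ?_,
      firstDigit_of_le h⟩
    refine eq_of_left_eq (le_antisymm ?_ (h1 ▸ h))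
    refine (le_left_or_right_le (left_mem i) s).resolve_right fun h'' => ?_
    linarith [left_lt_right i]
  · exact Or.inl ⟨h, firstDigit_of_lt ((left_lt_right i).trans_le h)⟩

lemma T_mem_of_mem_block (hP : IsMarkovPartition β P)
    (hs : block P s = Icc (1 / β) (1 / (β * (β - 1)))) {i : Fin (P.card - 1)} (hi : i ≠ s)
    {c : ℝ} (hc : c ∈ P) (hci : c ∈ block P i) : T β (firstDigit β (left P i)) c ∈ P := by
  rcases block_cases hP hs hi with ⟨h, hd⟩ | ⟨h, hd⟩
  · rw [hd]
    simpa [T] using hP.mul_mem c hc (hci.2.trans h)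
  · rw [hd]
    simpa [T] using hP.mul_sub_one_mem c hc (h.trans hci.1)

lemma greedyMap_eq_of_mem_block (hβ1 : 1 < β) (hβ2 : β < 2) (hP : IsMarkovPartition β P)
    (hs : block P s = Icc (1 / β) (1 / (β * (β - 1)))) {i : Fin (P.card - 1)} (hi : i ≠ s) {x : ℝ}
    (hx : x ∈ block P i) (hxs : x ∉ block P s) :
    greedyMap β x = T β (firstDigit β (left P i)) x := by
  have hlt := inv_lt_switchRight hβ1 hβ2
  rcases block_cases hP hs hi with ⟨h, hd⟩ | ⟨h, hd⟩
  · have : x < 1 / β := by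
      refine (hx.2.trans h).lt_of_ne fun e => hxs ?_
      rw [hs, e]
      exact ⟨le_rfl, hlt.le⟩
    rw [greedyMap_of_lt this, hd]
    simp [T]
  · rw [greedyMap_of_le (hlt.le.trans (h.trans hx.1)), hd]
    simp [T]

/-- The interval `[0, (β - 1)⁻¹]` is the union of the blocks. -/
lemma IsMarkovPartition.exists_mem_block (hβ1 : 1 < β) (hP : IsMarkovPartition β P) {x : ℝ}
    (hx : x ∈ Icc 0 (1 / (β - 1))) : ∃ i, x ∈ block P i := by
  obtain ⟨i, hi, -⟩ := BetaExpansion.exists_mem_block hP.zero_mem hP.fixed_mem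
    (one_div_pos.2 (by linarith)) hx
  exact ⟨i, hi⟩

lemma IsMarkovPartition.block_subset (hP : IsMarkovPartition β P) (i : Fin (P.card - 1)) :
    block P i ⊆ Icc 0 (1 / (β - 1)) :=
  Icc_subset_Icc (hP.mem_Icc _ (left_mem i)).1 (hP.mem_Icc _ (right_mem i)).2

lemma T_mem_Icc_of_mem_block (hβ1 : 1 < β) (hP : IsMarkovPartition β P)
    (hs : block P s = Icc (1 / β) (1 / (β * (β - 1)))) {i : Fin (P.card - 1)} (hi : i ≠ s) {x : ℝ}
    (hx : x ∈ block P i) : T β (firstDigit β (left P i)) x ∈ Icc 0 (1 / (β - 1)) := by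
  have hl := hP.mem_Icc _ (T_mem_of_mem_block hP hs hi (left_mem i) ⟨le_rfl, (left_lt_right i).le⟩)
  have hr := hP.mem_Icc _ (T_mem_of_mem_block hP hs hi (right_mem i) ⟨(left_lt_right i).le, le_rfl⟩)
  have hm := mem_image_of_mem (T β (firstDigit β (left P i))) hx
  rw [block, T_image_Icc hβ1] at hm
  exact ⟨hl.1.trans hm.1, hm.2.trans hr.2⟩

end Markov

/-! ### Spectral radius of complex matrices -/

section Spectral

variable {ι : Type*} [Fintype ι] [DecidableEq ι]

lemma mem_spectrum_iff_exists_mulVec (A : Matrix ι ι ℂ) (μ : ℂ) :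
    μ ∈ spectrum ℂ A ↔ ∃ v : ι → ℂ, v ≠ 0 ∧ A.mulVec v = μ • v := by
  rw [← Matrix.spectrum_toLin', ← Module.End.hasEigenvalue_iff_mem_spectrum]
  constructor
  · intro h
    obtain ⟨v, hv⟩ := h.exists_hasEigenvector
    exact ⟨v, hv.2, by simpa using hv.apply_eq_smul⟩
  · rintro ⟨v, hv, h⟩
    exact Module.End.hasEigenvalue_of_hasEigenvector (x := v)
      ⟨Module.End.mem_eigenspace_iff.2 (by simpa using h), hv⟩

lemma exists_eigenvector_nnnorm_eq_spectralRadius [Nonempty ι] (A : Matrix ι ι ℂ) :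
    ∃ (μ : ℂ) (v : ι → ℂ), v ≠ 0 ∧ A.mulVec v = μ • v ∧ (‖μ‖₊ : ENNReal) = spectralRadius ℂ A := by
  let _ : NormedRing (Matrix ι ι ℂ) := Matrix.linftyOpNormedRing
  let _ : NormedAlgebra ℂ (Matrix ι ι ℂ) := Matrix.linftyOpNormedAlgebra
  have _ : CompleteSpace (Matrix ι ι ℂ) := FiniteDimensional.complete ℂ _
  obtain ⟨μ, hμ, h⟩ := spectrum.exists_nnnorm_eq_spectralRadius A
  obtain ⟨v, hv, hv'⟩ := (mem_spectrum_iff_exists_mulVec A μ).1 hμ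
  exact ⟨μ, v, hv, hv', h⟩

/-- Gelfand's formula for the row sum norm. -/
lemma eventually_rowSum_pow_le (A : Matrix ι ι ℂ) {ρ : ℝ}
    (h : spectralRadius ℂ A < ENNReal.ofReal ρ) :
    ∀ᶠ n in Filter.atTop, ∀ i, ∑ j, ‖(A ^ n) i j‖ ≤ ρ ^ n := by
  let _ : NormedRing (Matrix ι ι ℂ) := Matrix.linftyOpNormedRing
  let _ : NormedAlgebra ℂ (Matrix ι ι ℂ) := Matrix.linftyOpNormedAlgebra
  have _ : CompleteSpace (Matrix ι ι ℂ) := FiniteDimensional.complete ℂ _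
  have ht := spectrum.pow_norm_pow_one_div_tendsto_nhds_spectralRadius A
  filter_upwards [ht.eventually_lt_const h, Filter.eventually_ge_atTop 1] with n hn h1 i
  have h2 : ‖A ^ n‖ ^ (1 / (n : ℝ)) < ρ := (ENNReal.ofReal_lt_ofReal_iff_of_nonneg
    (Real.rpow_nonneg (norm_nonneg _) _)).1 hn
  have h3 : ‖A ^ n‖ ≤ ρ ^ n := by
    rw [← Real.rpow_inv_natCast_pow (norm_nonneg (A ^ n)) (by omega : n ≠ 0), ← one_div]
    exact pow_le_pow_left₀ (Real.rpow_nonneg (norm_nonneg _) _) h2.le n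
  refine le_trans ?_ h3
  have h4 : ∑ j, ‖(A ^ n) i j‖₊ ≤ Finset.univ.sup fun i => ∑ j, ‖(A ^ n) i j‖₊ :=
    Finset.le_sup (f := fun i => ∑ j, ‖(A ^ n) i j‖₊) (Finset.mem_univ i)
  have h5 : ‖A ^ n‖ = ((Finset.univ.sup fun i => ∑ j, ‖(A ^ n) i j‖₊ : NNReal) : ℝ) :=
    Matrix.linfty_opNorm_def (A ^ n)
  rw [h5]
  simpa only [NNReal.coe_sum, coe_nnnorm] using NNReal.coe_le_coe.2 h4

end Spectral

/-! ### The upper bound -/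

/-- A set that, for every `n`, has a cover by `c n` sets of diameter `O(β⁻ⁿ)`, where `c` grows
slower than `βᵗⁿ`, has Hausdorff dimension at most `t`. -/
lemma dimH_le_of_covers {E : Set ℝ} {β L C ρ : ℝ} {t : NNReal} (hβ : 1 < β) (hL : 0 ≤ L)
    (hρ : 0 ≤ ρ) (hρt : ρ < β ^ (t : ℝ)) {c : ℕ → ℝ}
    (hc : ∀ᶠ n in Filter.atTop, c n ≤ C * ρ ^ n)
    (hcov : ∀ n, ∃ F : Finset (Set ℝ), (F.card : ℝ) ≤ c n ∧ E ⊆ ⋃₀ F ∧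
      ∀ A ∈ F, ∀ x ∈ A, ∀ y ∈ A, |x - y| ≤ L / β ^ n) :
    dimH E ≤ t := by
  have h0 : 0 < β := by linarith
  choose F hF hE hd using hcov
  have hdiam : ∀ n, ∀ A ∈ F n, Metric.ediam A ≤ ENNReal.ofReal (L / β ^ n) := by
    intro n A hA
    refine Metric.ediam_le fun x hx y hy => ?_
    rw [edist_dist]
    exact ENNReal.ofReal_le_ofReal (hd n A hA x hx y hy)
  have hLn : ∀ n, 0 ≤ L / β ^ n := fun n => by positivity
  have htend : Filter.Tendsto (fun n : ℕ => ENNReal.ofReal (L / β ^ n)) Filter.atTop (nhds 0) := by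
    rw [← ENNReal.ofReal_zero]
    refine ENNReal.tendsto_ofReal ?_
    have := (tendsto_pow_atTop_nhds_zero_of_lt_one (inv_nonneg.2 h0.le)
      (inv_lt_one_of_one_lt₀ hβ)).const_mul L
    simpa [div_eq_mul_inv] using this
  have hsum : ∀ᶠ n in Filter.atTop, ∑ A : F n, Metric.ediam (A : Set ℝ) ^ (t : ℝ) ≤
      ENNReal.ofReal (C * L ^ (t : ℝ) * (ρ / β ^ (t : ℝ)) ^ n) := by
    filter_upwards [hc] with n hn
    calc ∑ A : F n, Metric.ediam (A : Set ℝ) ^ (t : ℝ)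
        ≤ ∑ A : F n, ENNReal.ofReal ((L / β ^ n) ^ (t : ℝ)) := by
          refine Finset.sum_le_sum fun A _ => ?_
          rw [← ENNReal.ofReal_rpow_of_nonneg (hLn n) t.coe_nonneg]
          exact ENNReal.rpow_le_rpow (hdiam n A A.2) t.coe_nonneg
      _ = ENNReal.ofReal ((F n).card * (L / β ^ n) ^ (t : ℝ)) := by
          rw [Finset.sum_const, Finset.card_univ, Fintype.card_coe, nsmul_eq_mul,
            ENNReal.ofReal_mul (Nat.cast_nonneg _), ENNReal.ofReal_natCast]
      _ ≤ _ := by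
          refine ENNReal.ofReal_le_ofReal ?_
          have e : (L / β ^ n) ^ (t : ℝ) = L ^ (t : ℝ) / (β ^ (t : ℝ)) ^ n := by
            rw [Real.div_rpow hL (by positivity), ← Real.rpow_natCast, ← Real.rpow_natCast,
              ← Real.rpow_mul h0.le, ← Real.rpow_mul h0.le, mul_comm (n : ℝ)]
          calc ((F n).card : ℝ) * (L / β ^ n) ^ (t : ℝ)
              ≤ (C * ρ ^ n) * (L / β ^ n) ^ (t : ℝ) :=
                mul_le_mul_of_nonneg_right ((hF n).trans hn) (Real.rpow_nonneg (hLn n) _)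
            _ = _ := by rw [e, div_pow]; ring
  have hlim : Filter.Tendsto
      (fun n : ℕ => ENNReal.ofReal (C * L ^ (t : ℝ) * (ρ / β ^ (t : ℝ)) ^ n))
      Filter.atTop (nhds 0) := by
    rw [← ENNReal.ofReal_zero]
    refine ENNReal.tendsto_ofReal ?_
    have hpos : 0 < β ^ (t : ℝ) := Real.rpow_pos_of_pos h0 _
    simpa using (tendsto_pow_atTop_nhds_zero_of_lt_one (by positivity)
      ((div_lt_one hpos).2 hρt)).const_mul (C * L ^ (t : ℝ))
  have hlim' := tendsto_of_tendsto_of_tendsto_of_le_of_le' tendsto_const_nhds hlim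
    (Filter.Eventually.of_forall fun n => zero_le) hsum
  have hH := MeasureTheory.Measure.hausdorffMeasure_le_liminf_sum (t : ℝ) E
    (fun n => ENNReal.ofReal (L / β ^ n)) htend (fun n (A : F n) => (A : Set ℝ))
    (Filter.Eventually.of_forall fun n A => hdiam n A A.2)
    (Filter.Eventually.of_forall fun n x hx => by
      obtain ⟨A, hA, hxA⟩ := hE n hx
      exact mem_iUnion.2 ⟨⟨A, hA⟩, hxA⟩)
  rw [hlim'.liminf_eq] at hH
  exact dimH_le_of_hausdorffMeasure_ne_top (ne_top_of_le_ne_top ENNReal.zero_ne_top hH)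

section Upper

variable {β : ℝ} {P : Finset ℝ} {s : Fin (P.card - 1)}

open Classical in
/-- The reduced adjacency matrix with natural number entries. Its powers count the paths between
blocks that avoid the switch region. -/
noncomputable def reducedCount (β : ℝ) (P : Finset ℝ) (s : Fin (P.card - 1)) :
    Matrix {i // i ≠ s} {i // i ≠ s} ℕ := fun i j =>
  if T β (firstDigit β (left P i)) (left P i) ≤ left P j ∧
    right P j ≤ T β (firstDigit β (left P i)) (right P i) then 1 else 0

lemma reducedAdjacency_eq_map (hβ1 : 1 < β) :
    reducedAdjacency β P s = (reducedCount β P s).map (Nat.castRingHom ℂ) := by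
  ext i j
  simp only [reducedAdjacency, Matrix.submatrix_apply, adjacency_apply hβ1, Matrix.map_apply,
    reducedCount]
  split_ifs <;> simp

lemma norm_reducedAdjacency_pow (hβ1 : 1 < β) (n : ℕ) (i j : {i // i ≠ s}) :
    ‖(reducedAdjacency β P s ^ n) i j‖ = ((reducedCount β P s ^ n) i j : ℝ) := by
  rw [reducedAdjacency_eq_map hβ1, ← Matrix.map_pow]
  simp

/-- The points of `U_β` in a block are covered by as many intervals of length `O(β⁻ⁿ)` as there
are paths of length `n` from that block: the greedy map expands by `β` and stays in `U_β`. -/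
lemma exists_cover_univoqueSet_inter_block (hβ1 : 1 < β) (hβ2 : β < 2)
    (hP : IsMarkovPartition β P) (hs : block P s = Icc (1 / β) (1 / (β * (β - 1)))) (n : ℕ) :
    ∀ i : {i // i ≠ s}, ∃ F : Finset (Set ℝ), F.card ≤ ∑ j, (reducedCount β P s ^ n) i j ∧
      univoqueSet β ∩ block P i ⊆ ⋃₀ F ∧
      ∀ A ∈ F, ∀ x ∈ A, ∀ y ∈ A, |x - y| ≤ 1 / (β - 1) / β ^ n := by
  classical
  have h0 : 0 < β := by linarith
  induction n with
  | zero =>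
    intro i
    refine ⟨{block P i}, ?_, ?_, ?_⟩
    · simp [Matrix.one_apply]
    · simp
    · intro A hA x hx y hy
      rw [Finset.mem_singleton.1 hA] at hx hy
      have hx := hP.block_subset _ hx
      have hy := hP.block_subset _ hy
      rw [pow_zero, div_one, abs_le]
      constructor <;> linarith [hx.1, hx.2, hy.1, hy.2]
  | succ n ih =>
    intro i
    choose F hF hcov hd using ih
    set f := T β (firstDigit β (left P i)) with hf
    refine ⟨(Finset.univ.filter fun j => reducedCount β P s i j = 1).biUnion fun j =>
      (F j).image fun A => f ⁻¹' A, ?_, ?_, ?_⟩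
    · calc _ ≤ ∑ j with reducedCount β P s i j = 1, ((F j).image fun A => f ⁻¹' A).card :=
            Finset.card_biUnion_le
        _ ≤ ∑ j with reducedCount β P s i j = 1, ∑ k, (reducedCount β P s ^ n) j k :=
            Finset.sum_le_sum fun j _ => Finset.card_image_le.trans (hF j)
        _ = ∑ j, reducedCount β P s i j * ∑ k, (reducedCount β P s ^ n) j k := by
            rw [Finset.sum_filter]
            refine Finset.sum_congr rfl fun j _ => ?_
            by_cases h : reducedCount β P s i j = 1
            · simp [h]
            · have : reducedCount β P s i j = 0 := by
                simp only [reducedCount] at h ⊢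
                split_ifs at h ⊢ <;> simp_all
              simp [this]
        _ = ∑ k, (reducedCount β P s ^ (n + 1)) i k := by
            simp only [pow_succ', Matrix.mul_apply, Finset.mul_sum]
            rw [Finset.sum_comm]
    · rintro x ⟨hxU, hxi⟩
      have hxs : x ∉ block P s := hs ▸ notMem_switch_of_mem_univoqueSet hβ1 hβ2 hxU
      have hfU : f x ∈ univoqueSet β := by
        rw [hf, ← greedyMap_eq_of_mem_block hβ1 hβ2 hP hs i.2 hxi hxs]
        exact greedyMap_mem_univoqueSet hβ1 hβ2 hxU
      have hlr := left_lt_right (i : Fin (P.card - 1))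
      have hmem := mem_image_of_mem f hxi
      rw [block, T_image_Icc hβ1] at hmem
      obtain ⟨j, hj, h1, h2⟩ := exists_mem_block
        (T_mem_of_mem_block hP hs i.2 (left_mem _) ⟨le_rfl, hlr.le⟩)
        (T_mem_of_mem_block hP hs i.2 (right_mem _) ⟨hlr.le, le_rfl⟩)
        (by have := T_sub_T β (firstDigit β (left P i)) (right P i) (left P i)
            nlinarith) hmem
      have hjs : j ≠ s := by
        rintro rfl
        exact notMem_switch_of_mem_univoqueSet hβ1 hβ2 hfU (hs ▸ hj)
      obtain ⟨A, hA, hxA⟩ := hcov ⟨j, hjs⟩ ⟨hfU, hj⟩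
      refine ⟨f ⁻¹' A, Finset.mem_coe.2 (Finset.mem_biUnion.2
        ⟨⟨j, hjs⟩, ?_, Finset.mem_image_of_mem _ hA⟩), hxA⟩
      exact Finset.mem_filter.2 ⟨Finset.mem_univ _, if_pos ⟨h1, h2⟩⟩
    · intro B hB x hx y hy
      obtain ⟨j, -, hB⟩ := Finset.mem_biUnion.1 hB
      obtain ⟨A, hA, rfl⟩ := Finset.mem_image.1 hB
      have h := hd j A hA _ hx _ hy
      rw [hf, T_sub_T, abs_mul, abs_of_pos h0] at h
      rw [pow_succ, ← div_div, le_div_iff₀ h0]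
      linarith

lemma dimH_univoqueSet_le (hβ1 : 1 < β) (hβ2 : β < 2) (hP : IsMarkovPartition β P)
    (hs : block P s = Icc (1 / β) (1 / (β * (β - 1)))) {t : NNReal}
    (ht : spectralRadius ℂ (reducedAdjacency β P s) < ENNReal.ofReal (β ^ (t : ℝ))) :
    dimH (univoqueSet β) ≤ t := by
  classical
  obtain ⟨ρ, hρ, hrad, hρt⟩ := ENNReal.lt_iff_exists_real_btwn.1 ht
  have hρt : ρ < β ^ (t : ℝ) := (ENNReal.ofReal_lt_ofReal_iff_of_nonneg hρ).1 hρt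
  have hL : 0 < 1 / (β - 1) := one_div_pos.2 (by linarith)
  refine dimH_le_of_covers (c := fun n => ∑ i, ∑ j, ((reducedCount β P s ^ n) i j : ℝ))
    (L := 1 / (β - 1)) (C := Fintype.card {i // i ≠ s}) hβ1 hL.le hρ hρt ?_ ?_
  · filter_upwards [eventually_rowSum_pow_le _ hrad] with n hn
    simp only [norm_reducedAdjacency_pow hβ1] at hn
    refine (Finset.sum_le_sum fun i _ => hn i).trans_eq ?_
    simp
  · intro n
    choose F hF hcov hd using exists_cover_univoqueSet_inter_block hβ1 hβ2 hP hs n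
    refine ⟨Finset.univ.biUnion F, ?_, ?_, ?_⟩
    · have h : (Finset.univ.biUnion F).card ≤ ∑ i, ∑ j, (reducedCount β P s ^ n) i j :=
        Finset.card_biUnion_le.trans (Finset.sum_le_sum fun i _ => hF i)
      exact_mod_cast h
    · intro x hx
      obtain ⟨i, hi⟩ := hP.exists_mem_block hβ1 (univoqueSet_subset hβ1 hx)
      have his : i ≠ s := by
        rintro rfl
        exact notMem_switch_of_mem_univoqueSet hβ1 hβ2 hx (hs ▸ hi)
      obtain ⟨A, hA, hxA⟩ := hcov ⟨i, his⟩ ⟨hx, hi⟩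
      exact ⟨A, by simpa using ⟨i, his, hA⟩, hxA⟩
    · intro A hA
      obtain ⟨i, -, hA⟩ := Finset.mem_biUnion.1 hA
      exact hd i A hA

/-- The block at the fixed point `0` is mapped over itself, and no other block is mapped
over it. -/
lemma one_le_spectralRadius (hβ1 : 1 < β) (hβ2 : β < 2) (hP : IsMarkovPartition β P)
    (hs : block P s = Icc (1 / β) (1 / (β * (β - 1)))) :
    1 ≤ spectralRadius ℂ (reducedAdjacency β P s) := by
  classical
  have h0 : 0 < β := by linarith
  have hinv : 0 < 1 / β := by positivity
  have hlt := inv_lt_switchRight hβ1 hβ2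
  obtain ⟨o, ho⟩ := exists_left_eq hP.zero_mem hP.inv_mem hinv
  have hos : o ≠ s := by
    rintro rfl
    rw [(switch_endpoints hs).1] at ho
    linarith
  have hd : firstDigit β (left P o) = 0 := firstDigit_of_lt (ho ▸ hinv)
  have hspec : (1 : ℂ) ∈ spectrum ℂ (reducedAdjacency β P s) := by
    refine (mem_spectrum_iff_exists_mulVec _ _).2 ⟨Pi.single ⟨o, hos⟩ 1, ?_, ?_⟩
    · simp
    · rw [one_smul, Matrix.mulVec_single_one]
      ext i
      simp only [Matrix.col_apply, reducedAdjacency, Matrix.submatrix_apply, adjacency_apply hβ1,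
        ho]
      by_cases hio : i = ⟨o, hos⟩
      · subst hio
        rw [Pi.single_eq_same]
        refine if_pos ⟨?_, ?_⟩
        · rw [hd, ho]
          simp [T]
        · rw [hd]
          have := left_lt_right o
          simp only [T, Fin.val_zero, Nat.cast_zero, sub_zero]
          nlinarith
      · rw [Pi.single_eq_of_ne hio]
        refine if_neg fun h => hio (Subtype.ext (eq_of_left_eq ?_))
        have hi := hP.mem_Icc _ (left_mem (i : Fin (P.card - 1)))
        rcases block_cases hP hs i.2 with ⟨-, hd⟩ | ⟨hr, hd⟩
        · have h := h.1
          simp only [hd, T, Fin.val_zero, Nat.cast_zero, sub_zero] at h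
          show left P i = left P o
          nlinarith [hi.1]
        · have h := h.1
          simp only [hd, T, Fin.val_one, Nat.cast_one] at h
          have e : β * (1 / β) = 1 := by field_simp
          nlinarith
  have := le_iSup₂ (f := fun (k : ℂ) (_ : k ∈ spectrum ℂ (reducedAdjacency β P s)) =>
    (‖k‖₊ : ENNReal)) 1 hspec
  simpa [spectralRadius] using this

end Upper

/-! ### A Hölder function attached to an eigenvector -/

/-- A bounded function that is constant on the switch region and whose increments on every other
block are multiplied by `μ` under the expanding map of that block. If `μ` is the Perron eigenvalue,
an instance is the distribution function of a conformal measure on the univoque set. -/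
structure IsEigenprofile (β : ℝ) (P : Finset ℝ) (s : Fin (P.card - 1)) (μ : ℂ) (Φ : ℝ → ℂ) :
    Prop where
  bounded : ∃ B, ∀ x, ‖Φ x‖ ≤ B
  switch : ∀ x ∈ block P s, ∀ y ∈ block P s, Φ x = Φ y
  map_sub : ∀ i, i ≠ s → ∀ x ∈ block P i, ∀ y ∈ block P i,
    Φ (T β (firstDigit β (left P i)) x) - Φ (T β (firstDigit β (left P i)) y) = μ * (Φ x - Φ y)

lemma exists_bounded_eq_add_mul {X : Type*} (τ : X → X) (h : X → ℂ) {M : ℝ}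
    (hM : ∀ x, ‖h x‖ ≤ M) {q : ℂ} (hq : ‖q‖ < 1) :
    ∃ Φ : X → ℂ, (∃ B, ∀ x, ‖Φ x‖ ≤ B) ∧ ∀ x, Φ x = h x + q * Φ (τ x) := by
  have hg := (hasSum_geometric_of_lt_one (norm_nonneg q) hq).mul_right M
  have hb : ∀ x n, ‖q ^ n * h (τ^[n] x)‖ ≤ ‖q‖ ^ n * M := by
    intro x n
    rw [norm_mul, norm_pow]
    exact mul_le_mul_of_nonneg_left (hM _) (by positivity)
  have hs : ∀ x, Summable fun n => q ^ n * h (τ^[n] x) := fun x =>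
    Summable.of_norm_bounded hg.summable (hb x)
  refine ⟨fun x => ∑' n, q ^ n * h (τ^[n] x), ⟨_, fun x => tsum_of_norm_bounded hg (hb x)⟩,
    fun x => ?_⟩
  beta_reduce
  rw [(hs x).tsum_eq_zero_add, ← tsum_mul_left]
  simp only [pow_zero, one_mul, Function.iterate_zero_apply, Function.iterate_succ_apply]
  congr 2
  funext n
  ring

lemma eq_zero_of_bounded_of_eq_mul {X : Type*} {S : Set X} {τ : X → X} (hτ : MapsTo τ S S)
    {d : X → ℂ} {B : ℝ} (hB : ∀ x, ‖d x‖ ≤ B) {q : ℂ} (hq : ‖q‖ < 1)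
    (hd : ∀ x ∈ S, d x = q * d (τ x)) {x : X} (hx : x ∈ S) : d x = 0 := by
  have h : ∀ n : ℕ, ∀ y ∈ S, ‖d y‖ ≤ B * ‖q‖ ^ n := by
    intro n
    induction n with
    | zero => intro y _; simpa using hB y
    | succ n ih =>
      intro y hy
      rw [hd y hy, norm_mul, pow_succ]
      have := mul_le_mul_of_nonneg_left (ih _ (hτ hy)) (norm_nonneg q)
      linarith
  have ht := (tendsto_pow_atTop_nhds_zero_of_lt_one (norm_nonneg q) hq).const_mul B
  rw [mul_zero] at ht
  exact norm_le_zero_iff.1 (ge_of_tendsto' ht fun n => h n x hx)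

section Profile

variable {β : ℝ} {P : Finset ℝ} {s : Fin (P.card - 1)} {μ : ℂ}

/-- The eigenvector equation says that the increments of `blockSum` over blocks are multiplied by
`μ` when a block is replaced by its image. -/
lemma blockSum_T_right_sub_left (hβ1 : 1 < β) (hP : IsMarkovPartition β P)
    (hs : block P s = Icc (1 / β) (1 / (β * (β - 1)))) {w : Fin (P.card - 1) → ℂ} (hws : w s = 0)
    (hw : (reducedAdjacency β P s).mulVec (fun i => w i) = μ • fun i : {i // i ≠ s} => w i)
    {i : Fin (P.card - 1)} (hi : i ≠ s) :
    blockSum P w (T β (firstDigit β (left P i)) (right P i)) -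
      blockSum P w (T β (firstDigit β (left P i)) (left P i)) = μ * w i := by
  classical
  have h0 : 0 < β := by linarith
  have hlr := left_lt_right i
  rw [blockSum_sub w (T_mem_of_mem_block hP hs hi (left_mem _) ⟨le_rfl, hlr.le⟩)
    (by have := T_sub_T β (firstDigit β (left P i)) (right P i) (left P i)
        nlinarith)]
  have h := congrFun hw ⟨i, hi⟩
  simp only [Pi.smul_apply, smul_eq_mul] at h
  rw [← h, Finset.sum_filter]
  simp only [Matrix.mulVec, dotProduct, reducedAdjacency, Matrix.submatrix_apply,
    adjacency_apply hβ1, ite_mul, one_mul, zero_mul]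
  rw [Fintype.sum_eq_add_sum_subtype_ne _ s, hws, ite_self, zero_add]

/-- The greedy map, replaced by the identity on `[β⁻¹, β⁻¹(β - 1)⁻¹)`. The right endpoint of the
switch region belongs to the branch `T₁`, so that partition points are mapped to partition
points. -/
noncomputable def stoppedMap (β x : ℝ) : ℝ :=
  if x < 1 / β then β * x else if x < 1 / (β * (β - 1)) then x else β * x - 1

open Classical in
/-- The left endpoint of the half-open block containing `x`, or `x` if there is none. -/
noncomputable def blockStart (P : Finset ℝ) (x : ℝ) : ℝ :=
  if h : ∃ i, x ∈ Ico (left P i) (right P i) then left P h.choose else x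

lemma blockStart_of_mem_Ico {x : ℝ} {i : Fin (P.card - 1)}
    (hx : x ∈ Ico (left P i) (right P i)) : blockStart P x = left P i := by
  have h : ∃ i, x ∈ Ico (left P i) (right P i) := ⟨i, hx⟩
  rw [blockStart, dif_pos h, eq_of_mem_Ico h.choose_spec hx]

lemma blockStart_of_mem {c : ℝ} (hc : c ∈ P) : blockStart P c = c := by
  by_cases h : ∃ i, c ∈ Ico (left P i) (right P i)
  · obtain ⟨i, hi⟩ := h
    rw [blockStart_of_mem_Ico hi]
    exact le_antisymm hi.1 ((le_left_or_right_le hc i).resolve_right hi.2.not_ge)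
  · rw [blockStart, dif_neg h]

lemma stoppedMap_mem (hP : IsMarkovPartition β P) {c : ℝ} (hc : c ∈ P) : stoppedMap β c ∈ P := by
  unfold stoppedMap
  split_ifs with h1 h2
  · exact hP.mul_mem c hc h1.le
  · exact hc
  · exact hP.mul_sub_one_mem c hc (not_lt.1 h2)

lemma stoppedMap_of_mem_Ico (hβ1 : 1 < β) (hβ2 : β < 2) (hP : IsMarkovPartition β P)
    (hs : block P s = Icc (1 / β) (1 / (β * (β - 1)))) {i : Fin (P.card - 1)} (hi : i ≠ s) {x : ℝ}
    (hx : x ∈ Ico (left P i) (right P i)) :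
    stoppedMap β x = T β (firstDigit β (left P i)) x := by
  have hlt := inv_lt_switchRight hβ1 hβ2
  rcases block_cases hP hs hi with ⟨h, hd⟩ | ⟨h, hd⟩
  · rw [stoppedMap, if_pos (hx.2.trans_le h), hd]
    simp [T]
  · rw [stoppedMap, if_neg (hlt.le.trans (h.trans hx.1)).not_gt, if_neg (h.trans hx.1).not_gt, hd]
    simp [T]

/-- The increments of a profile over the blocks can be prescribed to be any eigenvector of the
reduced adjacency matrix for an eigenvalue outside the unit disc. -/
lemma exists_isEigenprofile (hβ1 : 1 < β) (hβ2 : β < 2) (hP : IsMarkovPartition β P)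
    (hs : block P s = Icc (1 / β) (1 / (β * (β - 1)))) (hμ : 1 < ‖μ‖) {v : {i // i ≠ s} → ℂ}
    (hv : (reducedAdjacency β P s).mulVec v = μ • v) :
    ∃ Φ : ℝ → ℂ, IsEigenprofile β P s μ Φ ∧
      ∀ i : {i // i ≠ s}, Φ (right P i) - Φ (left P i) = v i := by
  classical
  set w : Fin (P.card - 1) → ℂ := fun i => if h : i ≠ s then v ⟨i, h⟩ else 0 with hw
  have hws : w s = 0 := by simp [hw]
  have hwv : (fun i : {i // i ≠ s} => w i) = v := by
    funext i
    simp [hw, i.2]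
  set g := blockSum P w with hg
  have hμ0 : μ ≠ 0 := norm_pos_iff.1 (by linarith)
  have hq : ‖μ⁻¹‖ < 1 := by
    rw [norm_inv]
    exact inv_lt_one_of_one_lt₀ hμ
  have hgB := norm_blockSum_le w
  obtain ⟨Φ, ⟨B, hB⟩, hΦ⟩ := exists_bounded_eq_add_mul (stoppedMap β)
    (fun x => g (blockStart P x) - μ⁻¹ * g (stoppedMap β (blockStart P x)))
    (M := (∑ j, ‖w j‖) + ‖μ⁻¹‖ * ∑ j, ‖w j‖) (fun x => by
      refine (norm_sub_le _ _).trans (add_le_add (hgB _) ?_)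
      rw [norm_mul]
      exact mul_le_mul_of_nonneg_left (hgB _) (norm_nonneg _)) hq
  have hΦg : ∀ c ∈ P, Φ c = g c := by
    intro c hc
    refine sub_eq_zero.1 (eq_zero_of_bounded_of_eq_mul (S := (P : Set ℝ)) (τ := stoppedMap β)
      (d := fun x => Φ x - g x) (fun c hc => stoppedMap_mem hP hc)
      (fun x => (norm_sub_le _ _).trans (add_le_add (hB x) (hgB x))) hq ?_ hc)
    intro x hx
    rw [hΦ x, blockStart_of_mem hx]
    ring
  have hIco : ∀ i, ∀ x ∈ Ico (left P i) (right P i),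
      Φ x - Φ (left P i) = μ⁻¹ * (Φ (stoppedMap β x) - Φ (stoppedMap β (left P i))) := by
    intro i x hx
    rw [hΦ x, blockStart_of_mem_Ico hx, hΦg _ (left_mem i),
      hΦg _ (stoppedMap_mem hP (left_mem i))]
    ring
  have hinc : ∀ i, Φ (right P i) - Φ (left P i) = w i := by
    intro i
    rw [hΦg _ (right_mem i), hΦg _ (left_mem i), hg, blockSum_right_sub_left]
  have hswitch : ∀ x ∈ block P s, Φ x = Φ (left P s) := by
    intro x hx
    rcases hx.2.eq_or_lt with rfl | h
    · exact sub_eq_zero.1 ((hinc s).trans hws)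
    · obtain ⟨h1, h2⟩ := switch_endpoints hs
      have hid : ∀ y ∈ Ico (left P s) (right P s), stoppedMap β y = y := by
        intro y hy
        rw [h1, h2] at hy
        rw [stoppedMap, if_neg hy.1.not_gt, if_pos hy.2]
      have := hIco s x ⟨hx.1, h⟩
      rw [hid x ⟨hx.1, h⟩, hid _ ⟨le_rfl, left_lt_right s⟩] at this
      have hz : (1 - μ⁻¹) * (Φ x - Φ (left P s)) = 0 := by linear_combination this
      rcases mul_eq_zero.1 hz with h | h
      · have : ‖μ⁻¹‖ = 1 := by rw [← sub_eq_zero.1 h, norm_one]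
        linarith
      · exact sub_eq_zero.1 h
  have hmap : ∀ i, i ≠ s → ∀ x ∈ block P i, Φ (T β (firstDigit β (left P i)) x) -
      Φ (T β (firstDigit β (left P i)) (left P i)) = μ * (Φ x - Φ (left P i)) := by
    intro i hi x hx
    have hlr := left_lt_right i
    rcases hx.2.eq_or_lt with rfl | h
    · rw [hinc, hΦg _ (T_mem_of_mem_block hP hs hi (left_mem _) ⟨le_rfl, hlr.le⟩),
        hΦg _ (T_mem_of_mem_block hP hs hi (right_mem _) ⟨hlr.le, le_rfl⟩)]
      exact blockSum_T_right_sub_left hβ1 hP hs hws (by rw [hwv, hv]) hi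
    · rw [hIco i x ⟨hx.1, h⟩, stoppedMap_of_mem_Ico hβ1 hβ2 hP hs hi ⟨hx.1, h⟩,
        stoppedMap_of_mem_Ico hβ1 hβ2 hP hs hi ⟨le_rfl, hlr⟩, mul_inv_cancel_left₀ hμ0]
  refine ⟨Φ, ⟨⟨B, hB⟩, fun x hx y hy => (hswitch x hx).trans (hswitch y hy).symm,
    fun i hi x hx y hy => ?_⟩, fun i => (hinc i).trans (congrFun hwv i)⟩
  linear_combination hmap i hi x hx - hmap i hi y hy

end Profile

/-! ### Hölder regularity and the lower bound -/

/-- A bounded function whose increments over distances `δ β⁻ⁿ` are `O(β⁻ᵗⁿ)` is `t`-Hölder. -/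
lemma holderOnWith_of_geometric_scales {E : Set ℝ} {f : ℝ → ℝ} {β δ K : ℝ} {t : NNReal}
    (hβ : 1 < β) (hδ : 0 < δ) (hK : 0 ≤ K)
    (h : ∀ n : ℕ, ∀ x ∈ E, ∀ y ∈ E, |x - y| ≤ δ / β ^ n → |f x - f y| ≤ K / (β ^ (t : ℝ)) ^ n)
    (hK' : ∀ x ∈ E, ∀ y ∈ E, |f x - f y| ≤ K) : ∃ C, HolderOnWith C t f E := by
  have h0 : 0 < β := by linarith
  have hβt : 1 ≤ β ^ (t : ℝ) := Real.one_le_rpow hβ.le t.coe_nonneg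
  have hβt0 : 0 < β ^ (t : ℝ) := by linarith
  set C : ℝ := K * β ^ (t : ℝ) / δ ^ (t : ℝ) with hC
  have hδt : 0 < δ ^ (t : ℝ) := Real.rpow_pos_of_pos hδ _
  have hC0 : 0 ≤ C := by positivity
  have key : ∀ x ∈ E, ∀ y ∈ E, x ≠ y → |f x - f y| ≤ C * |x - y| ^ (t : ℝ) := by
    intro x hx y hy hxy
    have hpos : 0 < |x - y| := abs_pos.2 (sub_ne_zero.2 hxy)
    have hCd : C * |x - y| ^ (t : ℝ) = K * β ^ (t : ℝ) * (|x - y| / δ) ^ (t : ℝ) := by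
      rw [Real.div_rpow hpos.le hδ.le, hC]
      ring
    rw [hCd]
    have hdiv : 0 < |x - y| / δ := by positivity
    rcases le_or_gt (|x - y| / δ) 1 with hle | hgt
    · obtain ⟨n, hn1, hn2⟩ := exists_nat_pow_near_of_lt_one hdiv hle (inv_pos.2 h0)
        (inv_lt_one_of_one_lt₀ hβ)
      refine (h n x hx y hy ?_).trans ?_
      · rw [div_le_iff₀ hδ] at hn2
        rw [div_eq_mul_inv, ← inv_pow, mul_comm]
        exact hn2
      · have h1 : ((β⁻¹) ^ (n + 1)) ^ (t : ℝ) ≤ (|x - y| / δ) ^ (t : ℝ) :=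
          Real.rpow_le_rpow (by positivity) hn1.le t.coe_nonneg
        have h2 : ((β⁻¹) ^ (n + 1)) ^ (t : ℝ) = ((β ^ (t : ℝ)) ^ (n + 1))⁻¹ := by
          rw [inv_pow, Real.inv_rpow (by positivity), ← Real.rpow_natCast, ← Real.rpow_natCast,
            ← Real.rpow_mul h0.le, ← Real.rpow_mul h0.le, mul_comm (((n + 1 : ℕ) : ℝ))]
        rw [h2] at h1
        calc K / (β ^ (t : ℝ)) ^ n = K * β ^ (t : ℝ) * ((β ^ (t : ℝ)) ^ (n + 1))⁻¹ := by
              rw [pow_succ]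
              field_simp
          _ ≤ _ := mul_le_mul_of_nonneg_left h1 (by positivity)
    · refine (hK' x hx y hy).trans ?_
      have h1 : 1 ≤ (|x - y| / δ) ^ (t : ℝ) := Real.one_le_rpow hgt.le t.coe_nonneg
      have h2 : K ≤ K * β ^ (t : ℝ) := le_mul_of_one_le_right hK hβt
      exact h2.trans (le_mul_of_one_le_right (by positivity) h1)
  refine ⟨C.toNNReal, fun x hx y hy => ?_⟩
  rcases eq_or_ne x y with rfl | hxy
  · simp
  · rw [edist_dist, edist_dist, ENNReal.ofReal_rpow_of_nonneg dist_nonneg t.coe_nonneg]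
    change _ ≤ ENNReal.ofReal C * _
    rw [← ENNReal.ofReal_mul hC0]
    exact ENNReal.ofReal_le_ofReal (key x hx y hy hxy)

section Lower

variable {β : ℝ} {P : Finset ℝ} {s : Fin (P.card - 1)} {μ : ℂ} {Φ : ℝ → ℂ}

lemma exists_pos_le_block_length (P : Finset ℝ) :
    ∃ δ > 0, ∀ i : Fin (P.card - 1), δ ≤ right P i - left P i := by
  rcases isEmpty_or_nonempty (Fin (P.card - 1)) with h | h
  · exact ⟨1, one_pos, fun i => h.elim i⟩
  · obtain ⟨i, hi⟩ := Finite.exists_min fun i => right P i - left P i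
    exact ⟨_, sub_pos.2 (left_lt_right i), hi⟩

/-- Near a division point only one of the two adjacent blocks matters, and the image of the point
is again a division point, so its distance to a nearby point can be expanded repeatedly. -/
lemma IsEigenprofile.norm_sub_le_of_mem (hβ1 : 1 < β) (hP : IsMarkovPartition β P)
    (hs : block P s = Icc (1 / β) (1 / (β * (β - 1)))) (hΦ : IsEigenprofile β P s μ Φ)
    (hμ : 1 < ‖μ‖) {B δ : ℝ} (hB : ∀ x, ‖Φ x‖ ≤ B)
    (hδ : ∀ i : Fin (P.card - 1), δ ≤ right P i - left P i) (n : ℕ) :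
    ∀ c ∈ P, ∀ x ∈ Icc 0 (1 / (β - 1)), |x - c| ≤ δ / β ^ n →
      ‖Φ x - Φ c‖ ≤ 2 * B / ‖μ‖ ^ n := by
  have h0 : 0 < β := by linarith
  have hL : 0 < 1 / (β - 1) := one_div_pos.2 (by linarith)
  have hB0 : 0 ≤ B := (norm_nonneg _).trans (hB 0)
  induction n with
  | zero =>
    intro c _ x _ _
    rw [pow_zero, div_one, two_mul]
    exact (norm_sub_le _ _).trans (add_le_add (hB x) (hB c))
  | succ n ih =>
    intro c hc x hx hxc
    have hscale : β * |x - c| ≤ δ / β ^ n := by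
      rw [pow_succ, ← div_div, le_div_iff₀ h0] at hxc
      linarith
    obtain ⟨i, hxi, hci⟩ : ∃ i, x ∈ block P i ∧ c ∈ block P i := by
      obtain ⟨i, hi⟩ := hP.exists_mem_block hβ1 hx
      have hδ0 : 0 ≤ δ / β ^ (n + 1) := (abs_nonneg _).trans hxc
      have hpow : 1 ≤ β ^ (n + 1) := one_le_pow₀ hβ1.le
      have hδ' : δ / β ^ (n + 1) ≤ δ := by
        have : 0 ≤ δ := by
          by_contra hneg
          exact absurd hδ0 (div_neg_of_neg_of_pos (not_le.1 hneg) (by positivity)).not_ge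
        exact div_le_self this hpow
      have hcI := hP.mem_Icc c hc
      rcases le_or_gt c x with hcx | hcx
      · rw [abs_of_nonneg (sub_nonneg.2 hcx)] at hxc
        rcases hcI.2.eq_or_lt with hcL | hcL
        · have : x = c := le_antisymm (hcL ▸ hx.2) hcx
          exact ⟨i, hi, this ▸ hi⟩
        · obtain ⟨j, rfl⟩ := exists_left_eq hc hP.fixed_mem hcL
          exact ⟨j, ⟨hcx, by linarith [hδ j]⟩, ⟨le_rfl, (left_lt_right j).le⟩⟩
      · rw [abs_of_neg (sub_neg.2 hcx)] at hxc
        obtain ⟨j, rfl⟩ := exists_right_eq hc hP.zero_mem (hx.1.trans_lt hcx)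
        exact ⟨j, ⟨by linarith [hδ j], hcx.le⟩, ⟨(left_lt_right j).le, le_rfl⟩⟩
    by_cases his : i = s
    · subst his
      rw [hΦ.switch x hxi c hci, sub_self, norm_zero]
      positivity
    · have h := ih _ (T_mem_of_mem_block hP hs his hc hci) _
        (T_mem_Icc_of_mem_block hβ1 hP hs his hxi)
        (by rw [T_sub_T, abs_mul, abs_of_pos h0]; exact hscale)
      rw [hΦ.map_sub i his x hxi c hci, norm_mul] at h
      rw [pow_succ, ← div_div, le_div_iff₀ (by linarith)]
      linarith

lemma IsEigenprofile.norm_sub_le_of_abs_le (hβ1 : 1 < β) (hP : IsMarkovPartition β P)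
    (hs : block P s = Icc (1 / β) (1 / (β * (β - 1)))) (hΦ : IsEigenprofile β P s μ Φ)
    (hμ : 1 < ‖μ‖) {B δ : ℝ} (hB : ∀ x, ‖Φ x‖ ≤ B)
    (hδ : ∀ i : Fin (P.card - 1), δ ≤ right P i - left P i) (n : ℕ) :
    ∀ x ∈ Icc 0 (1 / (β - 1)), ∀ y ∈ Icc 0 (1 / (β - 1)), |x - y| ≤ δ / β ^ n →
      ‖Φ x - Φ y‖ ≤ 4 * B / ‖μ‖ ^ n := by
  have h0 : 0 < β := by linarith
  have hB0 : 0 ≤ B := (norm_nonneg _).trans (hB 0)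
  induction n with
  | zero =>
    intro x _ y _ _
    rw [pow_zero, div_one]
    exact (norm_sub_le _ _).trans (by linarith [hB x, hB y])
  | succ n ih =>
    intro x hx y hy hxy
    wlog hle : x ≤ y generalizing x y
    · rw [norm_sub_rev]
      exact this y hy x hx (by rwa [abs_sub_comm]) (not_le.1 hle).le
    obtain ⟨i, hi⟩ := hP.exists_mem_block hβ1 hx
    rcases le_or_gt y (right P i) with hyi | hyi
    · have hyi : y ∈ block P i := ⟨hi.1.trans hle, hyi⟩
      by_cases his : i = s
      · subst his
        rw [hΦ.switch x hi y hyi, sub_self, norm_zero]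
        positivity
      · have hscale : β * |x - y| ≤ δ / β ^ n := by
          rw [pow_succ, ← div_div, le_div_iff₀ h0] at hxy
          linarith
        have h := ih _ (T_mem_Icc_of_mem_block hβ1 hP hs his hi) _
          (T_mem_Icc_of_mem_block hβ1 hP hs his hyi)
          (by rw [T_sub_T, abs_mul, abs_of_pos h0]; exact hscale)
        rw [hΦ.map_sub i his x hi y hyi, norm_mul] at h
        rw [pow_succ, ← div_div, le_div_iff₀ (by linarith)]
        linarith
    · -- a division point separates `x` from `y`
      have hxr : |x - right P i| ≤ δ / β ^ (n + 1) := by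
        rw [abs_of_nonpos (by linarith [hi.2])]
        rw [abs_of_nonpos (by linarith)] at hxy
        linarith
      have hyr : |y - right P i| ≤ δ / β ^ (n + 1) := by
        rw [abs_of_nonneg (by linarith)]
        rw [abs_of_nonpos (by linarith)] at hxy
        linarith [hi.2]
      have h1 := hΦ.norm_sub_le_of_mem hβ1 hP hs hμ hB hδ (n + 1) _ (right_mem i) x hx hxr
      have h2 := hΦ.norm_sub_le_of_mem hβ1 hP hs hμ hB hδ (n + 1) _ (right_mem i) y hy hyr
      calc ‖Φ x - Φ y‖ = ‖(Φ x - Φ (right P i)) - (Φ y - Φ (right P i))‖ := by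
            rw [sub_sub_sub_cancel_right]
        _ ≤ 2 * B / ‖μ‖ ^ (n + 1) + 2 * B / ‖μ‖ ^ (n + 1) :=
            (norm_sub_le _ _).trans (add_le_add h1 h2)
        _ = 4 * B / ‖μ‖ ^ (n + 1) := by ring

/-- A profile takes only countably many values off the univoque set, because it is constant on
every connected set of points that enter the switch region along the same branches. -/
lemma IsEigenprofile.countable_image_diff (hβ1 : 1 < β) (hβ2 : β < 2) (hP : IsMarkovPartition β P)
    (hs : block P s = Icc (1 / β) (1 / (β * (β - 1)))) (hΦ : IsEigenprofile β P s μ Φ)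
    (hμ : μ ≠ 0) : (Φ '' (Icc 0 (1 / (β - 1)) \ univoqueSet β)).Countable := by
  have hswitch : (Φ '' block P s).Countable := by
    refine (countable_singleton (Φ (left P s))).mono ?_
    rintro _ ⟨x, hx, rfl⟩
    exact hΦ.switch x hx _ ⟨le_rfl, (left_lt_right s).le⟩
  have hn : ∀ n : ℕ, (Φ '' {x | x ∈ Icc 0 (1 / (β - 1)) ∧
      (greedyMap β)^[n] x ∈ block P s}).Countable := by
    intro n
    induction n with
    | zero =>
      refine hswitch.mono (image_mono ?_)
      rintro x ⟨-, hx⟩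
      exact hx
    | succ n ih =>
      refine (hswitch.union (countable_iUnion fun i : Fin (P.card - 1) => ih.image fun d =>
        Φ (left P i) + μ⁻¹ * (d - Φ (T β (firstDigit β (left P i)) (left P i))))).mono ?_
      rintro _ ⟨x, ⟨hx, hxn⟩, rfl⟩
      by_cases hxs : x ∈ block P s
      · exact Or.inl (mem_image_of_mem _ hxs)
      · obtain ⟨i, hi⟩ := hP.exists_mem_block hβ1 hx
        have his : i ≠ s := by
          rintro rfl
          exact hxs hi
        refine Or.inr (mem_iUnion.2 ⟨i, _, mem_image_of_mem _
          ⟨greedyMap_mem_Icc hβ1 hβ2 hx, by rwa [← Function.iterate_succ_apply]⟩, ?_⟩)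
        simp only
        rw [greedyMap_eq_of_mem_block hβ1 hβ2 hP hs his hi hxs,
          hΦ.map_sub i his x hi _ ⟨le_rfl, (left_lt_right i).le⟩, inv_mul_cancel_left₀ hμ,
          add_sub_cancel]
  refine (countable_iUnion hn).mono ?_
  rintro _ ⟨x, ⟨hx, hxU⟩, rfl⟩
  by_contra hnot
  refine hxU (mem_univoqueSet_of_forall_notMem_switch hβ1 hβ2 hx fun n hmem => hnot ?_)
  exact mem_iUnion.2 ⟨n, mem_image_of_mem _ ⟨hx, hs ▸ hmem⟩⟩

/-- The real part of a nonconstant profile maps the univoque set onto an interval up to countably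
many points, and it is Hölder with exponent `t`. -/
lemma IsEigenprofile.le_dimH_univoqueSet (hβ1 : 1 < β) (hβ2 : β < 2) (hP : IsMarkovPartition β P)
    (hs : block P s = Icc (1 / β) (1 / (β * (β - 1)))) (hΦ : IsEigenprofile β P s μ Φ)
    (hμ : 1 < ‖μ‖) {t : NNReal} (ht0 : 0 < t) (ht : β ^ (t : ℝ) = ‖μ‖) {i : Fin (P.card - 1)}
    (hi : Φ (right P i) - Φ (left P i) = 1) : (t : ENNReal) ≤ dimH (univoqueSet β) := by
  obtain ⟨B, hB⟩ := hΦ.bounded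
  obtain ⟨δ, hδ0, hδ⟩ := exists_pos_le_block_length P
  have hB0 : 0 ≤ B := (norm_nonneg _).trans (hB 0)
  set f : ℝ → ℝ := fun x => (Φ x).re with hf
  have hre : ∀ x y, |f x - f y| ≤ ‖Φ x - Φ y‖ := fun x y => by
    rw [hf]
    simp only
    rw [← Complex.sub_re]
    exact Complex.abs_re_le_norm _
  obtain ⟨C, hC⟩ : ∃ C, HolderOnWith C t f (Icc 0 (1 / (β - 1))) := by
    refine holderOnWith_of_geometric_scales (K := 4 * B) hβ1 hδ0 (by positivity) ?_ ?_
    · intro n x hx y hy hxy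
      rw [ht]
      exact (hre x y).trans (hΦ.norm_sub_le_of_abs_le hβ1 hP hs hμ hB hδ n x hx y hy hxy)
    · intro x _ y _
      exact ((hre x y).trans (norm_sub_le _ _)).trans (by linarith [hB x, hB y])
  have hlt : f (left P i) < f (right P i) := by
    have := congrArg Complex.re hi
    simp only [Complex.sub_re, Complex.one_re] at this
    simp only [hf]
    linarith
  have hcount : (f '' (Icc 0 (1 / (β - 1)) \ univoqueSet β)).Countable := by
    have := (hΦ.countable_image_diff hβ1 hβ2 hP hs (norm_pos_iff.1 (by linarith))).image Complex.re
    rwa [image_image] at this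
  have hsub : Icc (f (left P i)) (f (right P i)) ⊆
      f '' univoqueSet β ∪ f '' (Icc 0 (1 / (β - 1)) \ univoqueSet β) := by
    refine (intermediate_value_Icc (left_lt_right i).le
      ((hC.continuousOn ht0).mono (hP.block_subset i))).trans ?_
    rw [← image_union]
    refine image_mono fun x hx => ?_
    by_cases hxU : x ∈ univoqueSet β
    · exact Or.inl hxU
    · exact Or.inr ⟨hP.block_subset i hx, hxU⟩
  have h1 : dimH (Icc (f (left P i)) (f (right P i))) = 1 := by
    rw [Real.dimH_of_nonempty_interior (by rw [interior_Icc]; exact nonempty_Ioo.2 hlt)]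
    simp
  have h2 := dimH_mono hsub
  rw [h1, dimH_union, dimH_countable hcount, max_eq_left zero_le] at h2
  have h3 := h2.trans ((hC.mono (univoqueSet_subset hβ1)).dimH_image_le ht0)
  rw [ENNReal.le_div_iff_mul_le (Or.inl (by exact_mod_cast ht0.ne')) (Or.inl ENNReal.coe_ne_top),
    one_mul] at h3
  exact h3

end Lower

lemma dimH_univoqueSet_eq {β : ℝ} {P : Finset ℝ} {s : Fin (P.card - 1)} (hβ1 : 1 < β) (hβ2 : β < 2)
    (hP : IsMarkovPartition β P) (hs : block P s = Icc (1 / β) (1 / (β * (β - 1)))) :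
    ∃ r : ℝ, spectralRadius ℂ (reducedAdjacency β P s) = ENNReal.ofReal r ∧ 1 ≤ r ∧
      dimH (univoqueSet β) = ENNReal.ofReal (Real.log r / Real.log β) := by
  have h0 : 0 < β := by linarith
  have hone := one_le_spectralRadius hβ1 hβ2 hP hs
  have hne : Nonempty {i // i ≠ s} := by
    by_contra hempty
    rw [not_nonempty_iff] at hempty
    have : spectralRadius ℂ (reducedAdjacency β P s) = 0 := by
      rw [Subsingleton.elim (reducedAdjacency β P s) 0]
      simp
    rw [this] at hone
    exact absurd hone (by simp)
  obtain ⟨μ, v, hv0, hv, hrad⟩ :=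
    exists_eigenvector_nnnorm_eq_spectralRadius (reducedAdjacency β P s)
  have hrad : spectralRadius ℂ (reducedAdjacency β P s) = ENNReal.ofReal ‖μ‖ := by
    rw [← hrad, ofReal_norm]
    rfl
  have hμ1 : 1 ≤ ‖μ‖ := by
    rw [hrad, ENNReal.one_le_ofReal] at hone
    exact hone
  have hlogβ : 0 < Real.log β := Real.log_pos hβ1
  refine ⟨‖μ‖, hrad, hμ1, le_antisymm ?_ ?_⟩
  · by_contra hlt
    obtain ⟨t, ht1, ht2⟩ := ENNReal.lt_iff_exists_nnreal_btwn.1 (not_le.1 hlt)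
    refine ht2.not_ge (dimH_univoqueSet_le hβ1 hβ2 hP hs ?_)
    rw [hrad, ENNReal.ofReal_lt_ofReal_iff (Real.rpow_pos_of_pos h0 _),
      ← Real.log_lt_log_iff (by linarith) (Real.rpow_pos_of_pos h0 _), Real.log_rpow h0,
      ← div_lt_iff₀ hlogβ]
    rw [← ENNReal.ofReal_coe_nnreal] at ht1
    exact (ENNReal.ofReal_lt_ofReal_iff_of_nonneg
      (div_nonneg (Real.log_nonneg hμ1) hlogβ.le)).1 ht1
  · rcases hμ1.eq_or_lt with h1 | h1
    · simp [← h1]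
    · obtain ⟨i, hi⟩ := Function.ne_iff.1 hv0
      -- normalise the eigenvector so that the profile increases by exactly `1` over one block
      obtain ⟨Φ, hΦ, hinc⟩ := exists_isEigenprofile hβ1 hβ2 hP hs h1 (v := (v i)⁻¹ • v)
        (by rw [Matrix.mulVec_smul, hv, smul_comm])
      have hpos : 0 < Real.log ‖μ‖ / Real.log β := div_pos (Real.log_pos h1) hlogβ
      refine hΦ.le_dimH_univoqueSet hβ1 hβ2 hP hs h1 (t := (Real.log ‖μ‖ / Real.log β).toNNReal)
        (Real.toNNReal_pos.2 hpos) ?_ (i := i) ?_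
      · rw [Real.coe_toNNReal _ hpos.le, ← Real.logb, Real.rpow_logb h0 hβ1.ne' (by linarith)]
      · rw [hinc i, Pi.smul_apply, smul_eq_mul, inv_mul_cancel₀ hi]

end BetaExpansion

theorem theorem2 (β : ℝ) (hβ1 : 1 < β) (hβ2 : β < 2)
    (horbit : ∀ n : ℕ, 1 ≤ n →
      BetaExpansion.quasiGreedyOrbit β n ∉ Set.Ioc (1 / β) (1 / (β * (β - 1))))
    (hper : BetaExpansion.EventuallyPeriodic (BetaExpansion.greedyExpansion β 1)) :
    ∃ hfin : (BetaExpansion.partitionPoints β).Finite,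
      ∃ s : Fin (hfin.toFinset.card - 1),
        BetaExpansion.block hfin.toFinset s = Set.Icc (1 / β) (1 / (β * (β - 1))) ∧
        ∃ r : ℝ,
          spectralRadius ℂ (BetaExpansion.reducedAdjacency β hfin.toFinset s) =
            ENNReal.ofReal r ∧
          1 ≤ r ∧
          dimH (BetaExpansion.univoqueSet β) =
            ENNReal.ofReal (Real.log r / Real.log β) := by
  have hG := BetaExpansion.iterate_greedyMap_one_notMem hβ1 hβ2 horbit
  have hfin := BetaExpansion.finite_partitionPoints hβ1 hβ2 hG hper
  have hP := BetaExpansion.isMarkovPartition_partitionPoints hβ1 hβ2 hG hfin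
  obtain ⟨s, hs⟩ := hP.exists_switch hβ1 hβ2
  exact ⟨hfin, s, hs, BetaExpansion.dimH_univoqueSet_eq hβ1 hβ2 hP hs⟩
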